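/- Let $(R,\mathfrak m,K)$ be either a Noetherian local ring with maximal ideal $\mathfrak m$ and residue field $K$, or a standard graded Noetherian $K$-algebra ($K$ a field, $R=\bigoplus_{k\ge 0}R_k$, $R_0=K$, $R$ generated over $K$ by the finite-dimensional space $R_1$) with $\mathfrak m=\bigoplus_{k>0}R_k$. Assume that $K$ is infinite and $\operatorname{depth}R>0$, the depth being the supremum of the lengths of $R$-regular sequences in $\mathfrak m$. Let $I\subseteq R$ be an ideal, homogeneous in the graded case. An ideal $J$ is called $\mathfrak m$-full if $(J\mathfrak m:x)=J$ for generic $x\in\mathfrak m\setminus\mathfrak m^2$, full if $(J:x)=(J:\mathfrak m)$ for generic $x\in\mathfrak m\setminus\mathfrak m^2$, and weakly $\mathfrak m$-full if $(J\mathfrak m:\mathfrak m)=J$. Here a property holds for generic $x$ if it holds for all $x\in\mathfrak m\setminus\mathfrak m^2$ whose class lies in some non-empty Zariski open subset of the $K$-vector space $\mathfrak m/\mathfrak m^2$. Let $\mathfrak d_1(I)$, $\mathfrak d_2(I)$, $\mathfrak d_3(I)$ be the least $\ell\ge 0$ such that $I\mathfrak m^k$ is, for all $k\ge\ell$, $\mathfrak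 m$-full, full, weakly $\mathfrak m$-full, respectively. Let $\mathcal R(\mathfrak m)=\bigoplus_{k\ge 0}\mathfrak m^kt^k\subseteq R[t]=\mathcal R(R)$ be the Rees algebra, $Q=\bigoplus_{k>0}\mathfrak m^kt^k$, $\mathcal R(\mathfrak m,I)=\bigoplus_{k\ge 0}I\mathfrak m^kt^k$, and $\mathcal R(\mathfrak m,I)_{\ge 1}=\bigoplus_{k\ge 1}I\mathfrak m^kt^k$. For a finitely generated graded $\mathcal R(\mathfrak m)$-module $M\ne 0$ let $$\operatorname{reg}_{\mathcal R(\mathfrak m)}M=\max\{j-i: H_i(\mathbf y;M)_j\neq 0\},$$ where $H_i(\mathbf y;M)$ is the $i$th Koszul homology module and $\mathbf y=y_1,\dots,y_n$ is a minimal homogeneous system of generators of $Q$ (any such system may be used). Then $\mathfrak d_1(I),\mathfrak d_2(I),\mathfrak d_3(I)$ exist and $$\mathfrak d_2(I)\le\mathfrak d_3(I)=\mathfrak d_1(I).$$ If moreover $I\neq 0$, then the two regularities below exist and $$\mathfrak d_1(I)\le\max\bigl\{\operatorname{reg}_{\mathcal R(\mathfrak m)}\mathcal R(\mathfrak m,I),\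 \operatorname{reg}_{\mathcal R(\mathfrak m)}\bigl(\mathcal R(\mathfrak m,I)_{\ge 1}:_{\mathcal R(R)}\mathfrak m\bigr)\bigr\}.$$ Here $$\mathcal R(\mathfrak m,I)_{\ge 1}:_{\mathcal R(R)}\mathfrak m=\mathcal R(\mathfrak m,I)_{\ge 1}:_{\mathcal R(R)}\mathcal R(\mathfrak m,\mathfrak m)=\bigoplus_{k\ge 0}(I\mathfrak m^{k+1}:\mathfrak m)\,t^{k+1},$$ so that $(I\mathfrak m^{k+1}:\mathfrak m)$ is its component of degree $k+1$ and its component of degree $0$ vanishes. -/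

import Mathlib

universe u v

open Polynomial

noncomputable section

namespace Dao

/-! ### Standard graded algebras, depth -/

/-- `R = ⨁ 𝒜 k` is a standard graded `K`-algebra: `𝒜 0 = K`, and `R` is generated as a `K`-algebra
by the finite dimensional space `𝒜 1`. -/
structure IsStandardGraded {K : Type v} {R : Type u} [Field K] [CommRing R] [Algebra K R]
    (𝒜 : ℕ → Submodule K R) [GradedAlgebra 𝒜] : Prop where
  nontrivial : Nontrivial R
  degree_zero : 𝒜 0 = 1
  finite_degree_one : Module.Finite K (𝒜 1)
  adjoin_degree_one : Algebra.adjoin K (𝒜 1 : Set R) = ⊤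

/-- The depth of `R` with respect to `𝔪`: the supremum of the lengths of the `R`-regular sequences
in `𝔪`. -/
def depth {R : Type u} [CommRing R] (𝔪 : Ideal R) : ℕ∞ :=
  ⨆ rs ∈ {rs : List R | (∀ r ∈ rs, r ∈ 𝔪) ∧ RingTheory.Sequence.IsRegular R rs},
    (rs.length : ℕ∞)

/-! ### Generic elements and fullness -/

/-- The polynomial functions on a module `V`: the functions that are polynomials in linear forms. -/
def polynomialFunctions (K V : Type*) [CommRing K] [AddCommGroup V] [Module K V] :
    Subalgebra K (V → K) :=
  Algebra.adjoin K (Set.range fun φ : Module.Dual K V => (φ : V → K))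

/-- The open sets of the Zariski topology of `V`: complements of the common zero loci of sets of
polynomial functions. -/
def IsZariskiOpen (K : Type*) {V : Type*} [CommRing K] [AddCommGroup V] [Module K V]
    (U : Set V) : Prop :=
  ∃ S : Set (V → K), S ⊆ polynomialFunctions K V ∧ U = {v | ∃ f ∈ S, f v ≠ 0}

/-- The property `P` holds for a generic element `x ∈ 𝔪 ∖ 𝔪²`: it holds for all those
`x ∈ 𝔪 ∖ 𝔪²` whose class lies in a suitable non-empty Zariski open subset of the
`R ⧸ 𝔪`-vector space `𝔪 ⧸ 𝔪²`. -/
def ForGeneric {R : Type u} [CommRing R] (𝔪 : Ideal R) (P : R → Prop) : Prop :=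
  ∃ U : Set 𝔪.Cotangent, IsZariskiOpen (R ⧸ 𝔪) U ∧ U.Nonempty ∧
    ∀ x : 𝔪, (x : R) ∉ 𝔪 ^ 2 → 𝔪.toCotangent x ∈ U → P x

section Fullness

variable {R : Type u} [CommRing R] (𝔪 I : Ideal R)

/-- `I` is `𝔪`-full: `(I𝔪 : x) = I` for generic `x`. -/
def IsMFull : Prop :=
  ForGeneric 𝔪 fun x => (I * 𝔪).colon {x} = I

/-- `I` is full: `(I : x) = (I : 𝔪)` for generic `x`. -/
def IsFull : Prop :=
  ForGeneric 𝔪 fun x => I.colon {x} = I.colon (𝔪 : Set R)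

/-- `I` is weakly `𝔪`-full: `(I𝔪 : 𝔪) = I`. -/
def IsWeaklyMFull : Prop :=
  (I * 𝔪).colon (𝔪 : Set R) = I

/-- The set whose minimum is the first Dao number. -/
def daoSet₁ : Set ℕ := {l | ∀ k ≥ l, IsMFull 𝔪 (I * 𝔪 ^ k)}

/-- The set whose minimum is the second Dao number. -/
def daoSet₂ : Set ℕ := {l | ∀ k ≥ l, IsFull 𝔪 (I * 𝔪 ^ k)}

/-- The set whose minimum is the third Dao number. -/
def daoSet₃ : Set ℕ := {l | ∀ k ≥ l, IsWeaklyMFull 𝔪 (I * 𝔪 ^ k)}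

/-- The first Dao number (meaningful when `daoSet₁` is non-empty). -/
def daoNumber₁ : ℕ := sInf (daoSet₁ 𝔪 I)

/-- The second Dao number (meaningful when `daoSet₂` is non-empty). -/
def daoNumber₂ : ℕ := sInf (daoSet₂ 𝔪 I)

/-- The third Dao number (meaningful when `daoSet₃` is non-empty). -/
def daoNumber₃ : ℕ := sInf (daoSet₃ 𝔪 I)

end Fullness

/-! ### Koszul homology and Castelnuovo--Mumford regularity -/

section Koszul

variable {R : Type*} {A : Type*} {M : Type*} [CommRing R] [CommRing A] [Algebra R A]
  [AddCommGroup M] [Module A M] [Module R M] [IsScalarTower R A M] {n : ℕ}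

/-- The differential of the Koszul complex `⋀ Aⁿ ⊗ M` of `y₁, …, yₙ` with coefficients in `M`.
A function `f` stands for the element `∑ₛ e_s ⊗ f(s)`, where `e_s = e_{a₁} ∧ ⋯ ∧ e_{aᵢ}` for
`s = {a₁ < ⋯ < aᵢ}`, and the differential is
`e_s ⊗ m ↦ ∑ₖ (-1)ᵏ⁻¹ e_{s ∖ {aₖ}} ⊗ y_{aₖ} m`. -/
def koszulDifferential (M : Type*) [AddCommGroup M] [Module A M] (y : Fin n → A) :
    (Finset (Fin n) → M) →ₗ[A] (Finset (Fin n) → M) where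
  toFun f t := ∑ a ∈ tᶜ, ((-1) ^ (t.filter (· < a)).card * y a) • f (insert a t)
  map_add' f g := by
    funext t
    simp [Finset.sum_add_distrib]
  map_smul' c f := by
    funext t
    simp only [Pi.smul_apply, Finset.smul_sum, RingHom.id_apply]
    exact Finset.sum_congr rfl fun a _ => smul_comm _ _ _

/-- The Koszul complex is a complex. -/
theorem koszulDifferential_koszulDifferential (y : Fin n → A) (f : Finset (Fin n) → M) :
    koszulDifferential M y (koszulDifferential M y f) = 0 := by
  funext t
  simp only [koszulDifferential, LinearMap.coe_mk, AddHom.coe_mk, Pi.zero_apply, Finset.smul_sum]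
  rw [Finset.sum_sigma']
  refine Finset.sum_involution (fun p _ => ⟨p.2, p.1⟩) ?_ ?_ ?_ ?_
  · rintro ⟨a, b⟩ h
    simp only [Finset.mem_sigma, Finset.mem_compl, Finset.mem_insert, not_or] at h
    obtain ⟨ha, hb, hbt⟩ := h
    simp only [smul_smul]
    rw [Finset.insert_comm b a, ← add_smul]
    convert zero_smul A _
    simp only [Finset.filter_insert]
    rcases lt_or_gt_of_ne hb with h | h
    · rw [if_neg (not_lt.mpr h.le), if_pos h, Finset.card_insert_of_notMem (by simp [hbt])]
      ring
    · rw [if_pos h, if_neg (not_lt.mpr h.le), Finset.card_insert_of_notMem (by simp [ha])]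
      ring
  · rintro ⟨a, b⟩ h _ hab
    simp only [Finset.mem_sigma, Finset.mem_compl, Finset.mem_insert, not_or] at h
    simp only [Sigma.mk.injEq, heq_eq_eq] at hab
    tauto
  · rintro ⟨a, b⟩ h
    simp only [Finset.mem_sigma, Finset.mem_compl, Finset.mem_insert, not_or] at h ⊢
    exact ⟨h.2.2, fun e => h.2.1 e.symm, h.1⟩
  · rintro ⟨a, b⟩ h
    rfl

/-- The part of homological degree `i` and internal degree `j` of the Koszul complex, where
`M = ⨁ ℳ j` and `y₁, …, yₙ` (hence `e₁, …, eₙ`) have degree one. -/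
def koszulChains (ℳ : ℤ → Submodule R M) (n i : ℕ) (j : ℤ) :
    Submodule R (Finset (Fin n) → M) where
  carrier := {f | ∀ s : Finset (Fin n), (s.card = i → f s ∈ ℳ (j - i)) ∧ (s.card ≠ i → f s = 0)}
  add_mem' hf hg s :=
    ⟨fun h => add_mem ((hf s).1 h) ((hg s).1 h), fun h => by simp [(hf s).2 h, (hg s).2 h]⟩
  zero_mem' s := ⟨fun _ => zero_mem _, fun _ => rfl⟩
  smul_mem' c f hf s :=
    ⟨fun h => (ℳ _).smul_mem c ((hf s).1 h), fun h => by simp [(hf s).2 h]⟩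

/-- The cycles of homological degree `i` and internal degree `j`. -/
def koszulCycles (ℳ : ℤ → Submodule R M) (y : Fin n → A) (i : ℕ) (j : ℤ) :
    Submodule R (Finset (Fin n) → M) :=
  koszulChains ℳ n i j ⊓ LinearMap.ker ((koszulDifferential M y).restrictScalars R)

/-- The boundaries of homological degree `i` and internal degree `j`. -/
def koszulBoundaries (ℳ : ℤ → Submodule R M) (y : Fin n → A) (i : ℕ) (j : ℤ) :
    Submodule R (Finset (Fin n) → M) :=
  (koszulChains ℳ n (i + 1) j).map ((koszulDifferential M y).restrictScalars R)

/-- The component `Hᵢ(y; M)_j` of the Koszul homology. -/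
abbrev koszulHomology (ℳ : ℤ → Submodule R M) (y : Fin n → A) (i : ℕ) (j : ℤ) : Type _ :=
  koszulCycles ℳ y i j ⧸ (koszulBoundaries ℳ y i j).submoduleOf (koszulCycles ℳ y i j)

/-- `r` is the Castelnuovo--Mumford regularity of the graded module `M = ⨁ ℳ j`:
`r = max {j - i : Hᵢ(y; M)_j ≠ 0}`. -/
def IsRegularity (ℳ : ℤ → Submodule R M) (y : Fin n → A) (r : ℤ) : Prop :=
  IsGreatest {e : ℤ | ∃ (i : ℕ) (j : ℤ), Nontrivial (koszulHomology ℳ y i j) ∧ e = j - i} r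

end Koszul

/-! ### Rees algebras and the modules over them -/

section Rees

variable {R : Type u} [CommRing R] (𝔪 : Ideal R)

/-- `ℛ(𝔪, I) = ⨁ I𝔪ᵏ`, as a submodule of `R[t]` over the Rees algebra `ℛ(𝔪) = ⨁ 𝔪ᵏ tᵏ ⊆ R[t]`. -/
def reesModule (I : Ideal R) : Submodule (reesAlgebra 𝔪) R[X] where
  carrier := {f | ∀ k, f.coeff k ∈ I * 𝔪 ^ k}
  add_mem' hf hg k := by
    rw [coeff_add]
    exact add_mem (hf k) (hg k)
  zero_mem' k := by simp
  smul_mem' c f hf k := by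
    rw [Subalgebra.smul_def, smul_eq_mul, coeff_mul]
    refine Ideal.sum_mem _ fun p hp => ?_
    rw [← Finset.HasAntidiagonal.mem_antidiagonal.mp hp, pow_add, mul_left_comm]
    exact Ideal.mul_mem_mul (c.2 p.1) (hf p.2)

variable {𝔪}

/-- The truncation `N_{≥ 1}` of a graded submodule `N` of `R[t]`. -/
def truncation (N : Submodule (reesAlgebra 𝔪) R[X]) : Submodule (reesAlgebra 𝔪) R[X] where
  carrier := {f | f ∈ N ∧ f.coeff 0 = 0}
  add_mem' hf hg := ⟨add_mem hf.1 hg.1, by rw [coeff_add, hf.2, hg.2, add_zero]⟩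
  zero_mem' := ⟨zero_mem _, by simp⟩
  smul_mem' c f hf := ⟨N.smul_mem c hf.1, by
    rw [Subalgebra.smul_def, smul_eq_mul, mul_coeff_zero, hf.2, mul_zero]⟩

/-- The colon `N :_{R[t]} S = {f ∈ R[t] : S f ⊆ N}`, where `R[t]` is the Rees algebra `ℛ(R)` of the
unit ideal. -/
def polynomialColon (N : Submodule (reesAlgebra 𝔪) R[X]) (S : Set R[X]) :
    Submodule (reesAlgebra 𝔪) R[X] where
  carrier := {f | ∀ g ∈ S, g * f ∈ N}
  add_mem' hf hg s hs := by
    rw [mul_add]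
    exact add_mem (hf s hs) (hg s hs)
  zero_mem' s _ := by simp
  smul_mem' c f hf s hs := by
    rw [mul_smul_comm]
    exact N.smul_mem c (hf s hs)

variable (𝔪)

/-- `ℛ(𝔪, I)_{≥ 1} :_{ℛ(R)} 𝔪`. -/
def reesColon (I : Ideal R) : Submodule (reesAlgebra 𝔪) R[X] :=
  polynomialColon (truncation (reesModule 𝔪 I)) (C '' (𝔪 : Set R))

variable {𝔪}

/-- The homogeneous component of degree `j` of a graded submodule of `R[t]`, where `t` has
degree one. -/
def component (N : Submodule (reesAlgebra 𝔪) R[X]) (j : ℤ) : Submodule R N where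
  carrier := {f | ∀ k : ℕ, (k : ℤ) ≠ j → (f : R[X]).coeff k = 0}
  add_mem' hf hg k hk := by
    simp [hf k hk, hg k hk]
  zero_mem' k _ := by simp
  smul_mem' c f hf k hk := by
    simp [hf k hk]

variable (𝔪)

/-- The ideal `Q = ℛ(𝔪)₊ = ⨁_{k > 0} 𝔪ᵏ tᵏ` of the Rees algebra. -/
def reesIrrelevant : Ideal (reesAlgebra 𝔪) where
  carrier := {f | (f : R[X]).coeff 0 = 0}
  add_mem' hf hg := by
    simp only [Set.mem_ofPred_eq] at hf hg ⊢
    simp [hf, hg]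
  zero_mem' := by simp
  smul_mem' c f hf := by
    simp only [Set.mem_ofPred_eq] at hf ⊢
    simp [mul_coeff_zero, hf]

/-- `y₁, …, yₙ` is a minimal homogeneous system of generators of `Q = ℛ(𝔪)₊`. (Such `yₐ` are
automatically of degree one, since `Q` is generated in degree one.) -/
structure IsMinimalHomogeneousGenerators {n : ℕ} (y : Fin n → reesAlgebra 𝔪) : Prop where
  homogeneous : ∀ a, ∃ d : ℕ, ∀ k, k ≠ d → (y a : R[X]).coeff k = 0
  span_eq : Ideal.span (Set.range y) = reesIrrelevant 𝔪
  minimal : ∀ a, Ideal.span (y '' {a}ᶜ) ≠ reesIrrelevant 𝔪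

end Rees

end Dao

end

/-! Write `N` for the colon module, with `N_{k+1} = (I𝔪^{k+1} : 𝔪)` and `N_0 = 0`. Positive depth
gives a nonzerodivisor `z ∈ 𝔪`; multiplication by `z` embeds `N` into the Noetherian ring `ℛ(𝔪)`, so
`N` is finitely generated. Koszul homology is killed by `Q`, hence finitely generated over `R` and
bounded in degree, which makes the regularities exist. If `H₀(y; N)_{k+1} = 0` and `k ≥ 1`, then
`(I𝔪^{k+1} : 𝔪) = 𝔪 (I𝔪^k : 𝔪) ⊆ I𝔪^k`, so `I𝔪^k` is weakly `𝔪`-full. Thus the third Dao number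
exists and is bounded by `reg N` alone.

Passing from weakly `𝔪`-full to `𝔪`-full takes two steps. First, a generic `x` satisfies `(I𝔪^{k+1}
: x) = I𝔪^k` for large `k` (`exists_finset_dual_forall_colon_le`): each associated prime of
`ℛ(𝔪)/ℛ(𝔪, I)` not containing `Q` excludes only a proper subspace of `𝔪/𝔪²`, and weak fullness
removes the remaining `Q`-torsion in high degrees. Second, the equality descends to every `k` from
which weak fullness holds: `yx ∈ I𝔪^{k+1}` gives `(y𝔪)x ⊆ I𝔪^{k+2}`, so `y𝔪 ⊆ I𝔪^{k+1}` and `y ∈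
I𝔪^k`. The other implications are formal once a generic property is known to hold for some `x`.

The local and graded cases are treated together through `IsSaturatedAt`: elements outside `𝔪` need
not be units, but act injectively modulo the ideals involved. -/

set_option synthInstance.maxHeartbeats 200000

noncomputable section

namespace Dao

/-! ### Koszul homology is annihilated by the ideal of the sequence -/

section KoszulHomotopy

variable {A : Type*} {M : Type*} [CommRing A] [AddCommGroup M] [Module A M] {n : ℕ}

/-- Exterior multiplication by `e_a` on the Koszul complex. -/
def koszulHomotopy (a : Fin n) (f : Finset (Fin n) → M) : Finset (Fin n) → M :=
  fun t => if a ∈ t then (-1 : A) ^ (t.filter (· < a)).card • f (t.erase a) else 0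

/-- Exterior multiplication by `e_a` contracts multiplication by `y_a` on cycles. -/
theorem koszulDifferential_koszulHomotopy (y : Fin n → A) (a : Fin n) (f : Finset (Fin n) → M)
    (hf : koszulDifferential M y f = 0) :
    koszulDifferential M y (koszulHomotopy (A := A) a f) = y a • f := by
  have sq : ∀ m : ℕ, (-1 : A) ^ m * (-1) ^ m = 1 := fun m => by
    rw [← mul_pow]; simp
  funext t
  simp only [koszulDifferential, LinearMap.coe_mk, AddHom.coe_mk, koszulHomotopy, Pi.smul_apply]
  by_cases hat : a ∈ t
  -- The cycle condition at `t ∖ {a}` expresses `y_a f(t)` through the summands over `b ∉ t`; only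
  -- the signs remain to be compared.
  · have h0 := congrFun hf (t.erase a)
    simp only [koszulDifferential, LinearMap.coe_mk, AddHom.coe_mk, Pi.zero_apply] at h0
    have hc : (t.erase a)ᶜ = insert a tᶜ := by
      ext b; simp only [Finset.mem_compl, Finset.mem_erase, Finset.mem_insert]; tauto
    rw [hc, Finset.sum_insert (by simpa using hat), Finset.insert_erase hat] at h0
    have hfa : (t.erase a).filter (· < a) = t.filter (· < a) := by
      ext b; simp only [Finset.mem_filter, Finset.mem_erase]
      exact ⟨fun h => ⟨h.1.2, h.2⟩, fun h => ⟨⟨h.2.ne, h.1⟩, h.2⟩⟩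
    rw [hfa] at h0
    have h1 := congrArg (fun m => (-1 : A) ^ (t.filter (· < a)).card • m) h0
    simp only [smul_add, smul_zero, smul_smul, Finset.smul_sum, ← mul_assoc, sq, one_mul] at h1
    rw [eq_neg_of_add_eq_zero_left h1, ← Finset.sum_neg_distrib]
    refine Finset.sum_congr rfl fun b hb => ?_
    have hbt : b ∉ t := by simpa using hb
    have hba : b ≠ a := fun h => hbt (h ▸ hat)
    rw [if_pos (Finset.mem_insert_of_mem hat), Finset.erase_insert_of_ne hba, smul_smul,
      ← neg_smul]
    congr 1
    rw [Finset.filter_insert]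
    have ht : ∀ p : Fin n → Prop, ∀ [DecidablePred p], p a →
        (t.filter p).card = ((t.erase a).filter p).card + 1 := fun p _ hp => by
      rw [Finset.filter_erase, Finset.card_erase_add_one (by simp [hat, hp])]
    rcases lt_or_gt_of_ne hba with h | h
    · rw [if_pos h, Finset.card_insert_of_notMem (by simp [hbt]), Finset.filter_erase,
        Finset.erase_eq_of_notMem (s := t.filter (· < b)) (by simp [h.le])]
      ring
    · rw [if_neg (not_lt.mpr h.le), ht (· < b) h]
      ring
  · rw [Finset.sum_eq_single a]
    · rw [if_pos (Finset.mem_insert_self a t), Finset.erase_insert hat, smul_smul,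
        Finset.filter_insert, if_neg (lt_irrefl a), mul_right_comm, sq, one_mul]
    · intro b _ hb
      rw [if_neg (by simp [hat, hb.symm]), smul_zero]
    · intro h; exact absurd (Finset.mem_compl.mpr hat) h

/-- The ideal generated by `y` carries cycles of the Koszul complex to boundaries. -/
theorem smul_mem_range_koszulDifferential (y : Fin n → A) {c : A}
    (hc : c ∈ Ideal.span (Set.range y)) {f : Finset (Fin n) → M}
    (hf : koszulDifferential M y f = 0) :
    c • f ∈ LinearMap.range (koszulDifferential M y) := by
  have : Ideal.span (Set.range y) ≤
      (LinearMap.range (koszulDifferential M y)).comap (LinearMap.toSpanSingleton A _ f) := by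
    rw [Ideal.span_le]
    rintro _ ⟨a, rfl⟩
    exact ⟨_, koszulDifferential_koszulHomotopy y a f hf⟩
  exact this hc

end KoszulHomotopy

/-! ### Graded submodules of `R[t]` and projections of the Koszul complex -/

section GradedSubmodules

variable {R : Type u} [CommRing R] {𝔪 : Ideal R} (N : Submodule (reesAlgebra 𝔪) R[X])

/-- A submodule of `R[t]` is graded if it contains the homogeneous components of its elements. -/
def IsGraded : Prop := ∀ f ∈ N, ∀ k, monomial k (f.coeff k) ∈ N

variable {N}

/-- The projection of a graded submodule of `R[t]` onto its component of degree `j`. -/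
def componentProj (hN : IsGraded N) (j : ℤ) : N →ₗ[R] N where
  toFun f := ⟨if 0 ≤ j then monomial j.toNat ((f : R[X]).coeff j.toNat) else 0, by
    split_ifs
    · exact hN f f.2 _
    · exact zero_mem _⟩
  map_add' f g := by
    ext1
    by_cases h : 0 ≤ j <;> simp [h]
  map_smul' c f := by
    ext1
    by_cases h : 0 ≤ j <;> simp [h, smul_monomial]

theorem coeff_componentProj (hN : IsGraded N) (j : ℤ) (f : N) (k : ℕ) :
    (componentProj hN j f : R[X]).coeff k = if (k : ℤ) = j then (f : R[X]).coeff k else 0 := by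
  simp only [componentProj, LinearMap.coe_mk, AddHom.coe_mk]
  split_ifs with h1 h2 h2
  · subst h2; simp
  · rw [coeff_monomial, if_neg (by omega)]
  · omega
  · simp

theorem componentProj_mem (hN : IsGraded N) (j : ℤ) (f : N) :
    componentProj hN j f ∈ component N j := fun k hk => by
  rw [coeff_componentProj, if_neg hk]

theorem componentProj_eq_self (hN : IsGraded N) {j : ℤ} {f : N} (hf : f ∈ component N j) :
    componentProj hN j f = f := by
  ext k
  rw [coeff_componentProj]
  split_ifs with h
  · rfl
  · exact (hf k h).symm

theorem componentProj_eq_zero (hN : IsGraded N) {j : ℤ} {f : N}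
    (hf : ((f : R[X]).natDegree : ℤ) < j) : componentProj hN j f = 0 := by
  ext k
  rw [coeff_componentProj]
  split_ifs with h
  · rw [coeff_eq_zero_of_natDegree_lt (by omega)]; simp
  · simp

/-- An element of the Rees algebra is homogeneous of degree one. -/
def IsDegreeOne (y : reesAlgebra 𝔪) : Prop := ∀ k, k ≠ 1 → (y : R[X]).coeff k = 0

theorem IsDegreeOne.eq_monomial {y : reesAlgebra 𝔪} (hy : IsDegreeOne y) :
    (y : R[X]) = monomial 1 ((y : R[X]).coeff 1) := by
  ext k
  rw [coeff_monomial]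
  split_ifs with h
  · rw [h]
  · exact hy k (Ne.symm h)

theorem IsDegreeOne.coeff_smul_zero {y : reesAlgebra 𝔪} (hy : IsDegreeOne y) (f : N) :
    ((y • f : N) : R[X]).coeff 0 = 0 := by
  rw [Submodule.coe_smul, Subalgebra.smul_def, smul_eq_mul, mul_coeff_zero, hy 0 (by simp),
    zero_mul]

theorem IsDegreeOne.coeff_smul_succ {y : reesAlgebra 𝔪} (hy : IsDegreeOne y) (f : N) (k : ℕ) :
    ((y • f : N) : R[X]).coeff (k + 1) = (y : R[X]).coeff 1 * (f : R[X]).coeff k := by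
  rw [Submodule.coe_smul, Subalgebra.smul_def, smul_eq_mul, hy.eq_monomial, coeff_monomial_mul,
    coeff_monomial_same]

theorem componentProj_smul (hN : IsGraded N) {y : reesAlgebra 𝔪} (hy : IsDegreeOne y) (j : ℤ)
    (f : N) : componentProj hN j (y • f) = y • componentProj hN (j - 1) f := by
  ext k
  rw [coeff_componentProj]
  cases k with
  | zero => rw [hy.coeff_smul_zero, hy.coeff_smul_zero, ite_self]
  | succ k =>
    rw [hy.coeff_smul_succ, hy.coeff_smul_succ, coeff_componentProj, mul_ite, mul_zero]
    exact if_congr (by push_cast; omega) rfl rfl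

variable {n : ℕ}

/-- The projection of the Koszul complex onto its part of homological degree `i` and internal
degree `j`. -/
def chainProj (hN : IsGraded N) (n i : ℕ) (j : ℤ) :
    (Finset (Fin n) → N) →ₗ[R] (Finset (Fin n) → N) where
  toFun f s := if s.card = i then componentProj hN (j - i) (f s) else 0
  map_add' f g := by
    funext s
    by_cases h : s.card = i <;> simp [h]
  map_smul' c f := by
    funext s
    by_cases h : s.card = i <;> simp [h]

theorem chainProj_mem (hN : IsGraded N) (i : ℕ) (j : ℤ) (f : Finset (Fin n) → N) :
    chainProj hN n i j f ∈ koszulChains (component N) n i j := fun s =>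
  ⟨fun h => by
    simp only [chainProj, LinearMap.coe_mk, AddHom.coe_mk, if_pos h]
    exact componentProj_mem _ _ _,
  fun h => by simp only [chainProj, LinearMap.coe_mk, AddHom.coe_mk, if_neg h]⟩

theorem chainProj_eq_self (hN : IsGraded N) {i : ℕ} {j : ℤ} {f : Finset (Fin n) → N}
    (hf : f ∈ koszulChains (component N) n i j) : chainProj hN n i j f = f := by
  funext s
  simp only [chainProj, LinearMap.coe_mk, AddHom.coe_mk]
  split_ifs with h
  · exact componentProj_eq_self hN ((hf s).1 h)
  · exact ((hf s).2 h).symm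

/-- Each `y_a` has the same degree as `e_a`, so the differential preserves the internal degree. -/
theorem chainProj_koszulDifferential (hN : IsGraded N) {y : Fin n → reesAlgebra 𝔪}
    (hy : ∀ a, IsDegreeOne (y a)) (i : ℕ) (j : ℤ) (f : Finset (Fin n) → N) :
    chainProj hN n i j (koszulDifferential N y f) =
      koszulDifferential N y (chainProj hN n (i + 1) j f) := by
  funext t
  simp only [chainProj, koszulDifferential, LinearMap.coe_mk, AddHom.coe_mk]
  -- The projections are only `R`-linear, so signs are moved from the Rees algebra to `R`.
  have hs : ∀ (m : ℕ) (g : N), (-1 : reesAlgebra 𝔪) ^ m • g = (-1 : R) ^ m • g := fun m g => by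
    rw [← algebraMap_smul (reesAlgebra 𝔪) ((-1 : R) ^ m) g]; simp
  split_ifs with h
  · rw [map_sum]
    refine Finset.sum_congr rfl fun a ha => ?_
    rw [if_pos (by rw [Finset.card_insert_of_notMem (by simpa using ha), h]), mul_smul, mul_smul,
      hs, hs, map_smul, componentProj_smul hN (hy a)]
    congr 4
    push_cast; ring
  · refine (Finset.sum_eq_zero fun a ha => ?_).symm
    rw [if_neg (by rw [Finset.card_insert_of_notMem (by simpa using ha)]; omega), smul_zero]

end GradedSubmodules

/-! ### Existence of the regularity -/

section Regularity

theorem nontrivial_quotient_submoduleOf_iff {R M : Type*} [Ring R] [AddCommGroup M] [Module R M]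
    (p q : Submodule R M) : Nontrivial (p ⧸ q.submoduleOf p) ↔ ¬ p ≤ q :=
  Submodule.Quotient.nontrivial_iff.trans (not_congr Submodule.submoduleOf_eq_top)

theorem nontrivial_koszulHomology_iff {R A M : Type*} [CommRing R] [CommRing A] [Algebra R A]
    [AddCommGroup M] [Module A M] [Module R M] [IsScalarTower R A M] {n : ℕ}
    (ℳ : ℤ → Submodule R M) (y : Fin n → A) (i : ℕ) (j : ℤ) :
    Nontrivial (koszulHomology ℳ y i j) ↔ ¬ koszulCycles ℳ y i j ≤ koszulBoundaries ℳ y i j :=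
  nontrivial_quotient_submoduleOf_iff _ _

theorem smul_eq_smul_add_sub_smul {R A M : Type*} [CommRing R] [CommRing A] [Algebra R A]
    [AddCommGroup M] [Module A M] [Module R M] [IsScalarTower R A M] (r : R) (c : A) (f : M) :
    c • f = r • f + (c - algebraMap R A r) • f := by
  rw [sub_smul, algebraMap_smul, add_sub_cancel]

variable {R : Type u} [CommRing R] {𝔪 : Ideal R} {N : Submodule (reesAlgebra 𝔪) R[X]} {n : ℕ}

/-- The cycles of homological degree `i` of the Koszul complex, as a module over the Rees
algebra. -/
def totalCycles (N : Submodule (reesAlgebra 𝔪) R[X]) (y : Fin n → reesAlgebra 𝔪) (i : ℕ) :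
    Submodule (reesAlgebra 𝔪) (Finset (Fin n) → N) where
  carrier := {f | koszulDifferential N y f = 0 ∧ ∀ s, s.card ≠ i → f s = 0}
  add_mem' hf hg := ⟨by rw [map_add, hf.1, hg.1, add_zero],
    fun s hs => by rw [Pi.add_apply, hf.2 s hs, hg.2 s hs, add_zero]⟩
  zero_mem' := ⟨map_zero _, fun _ _ => rfl⟩
  smul_mem' c f hf := ⟨by rw [map_smul, hf.1, smul_zero],
    fun s hs => by rw [Pi.smul_apply, hf.2 s hs, smul_zero]⟩

theorem sub_algebraMap_mem_reesIrrelevant (c : reesAlgebra 𝔪) :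
    c - algebraMap R _ ((c : R[X]).coeff 0) ∈ reesIrrelevant 𝔪 := by
  change ((c - algebraMap R _ ((c : R[X]).coeff 0) : reesAlgebra 𝔪) : R[X]).coeff 0 = 0
  rw [AddSubgroupClass.coe_sub, Subalgebra.coe_algebraMap, coeff_sub, Polynomial.algebraMap_apply]
  simp

/-- The Koszul homology in a fixed homological degree vanishes in large internal degrees. -/
theorem exists_forall_koszulCycles_le [IsNoetherianRing R] (hN : IsGraded N)
    [IsNoetherian (reesAlgebra 𝔪) N] {y : Fin n → reesAlgebra 𝔪} (hy : ∀ a, IsDegreeOne (y a))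
    (hspan : Ideal.span (Set.range y) = reesIrrelevant 𝔪) (i : ℕ) :
    ∃ D : ℕ, ∀ j : ℤ, D < j - i →
      koszulCycles (M := N) (component N) y i j ≤ koszulBoundaries (M := N) (component N) y i j := by
  have : IsNoetherian (reesAlgebra 𝔪) (Finset (Fin n) → N) :=
    isNoetherian_pi (R := reesAlgebra 𝔪) (M := fun _ => N)
  obtain ⟨T, hT⟩ := IsNoetherian.noetherian (totalCycles N y i)
  -- The bound is the largest degree in `t` of a coefficient of the finitely many generating cycles.
  refine ⟨T.sup fun f => Finset.univ.sup fun s => (f s : R[X]).natDegree, fun j hj => ?_⟩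
  -- Modulo boundaries every cycle is an `R`-combination of the generators, since scalars from `Q`
  -- turn cycles into boundaries; in degree `j` the generators project to zero.
  have key : ∀ f ∈ totalCycles N y i, ∃ w,
      chainProj hN n i j f = chainProj hN n i j (koszulDifferential N y w) := by
    rw [← hT]
    intro f hf
    induction hf using Submodule.span_induction with
    | mem f hf =>
      refine ⟨0, ?_⟩
      rw [map_zero, map_zero]
      funext s
      simp only [chainProj, LinearMap.coe_mk, AddHom.coe_mk]
      split_ifs
      · refine componentProj_eq_zero hN (lt_of_le_of_lt ?_ hj)
        have h1 := Finset.le_sup (f := fun s => (f s : R[X]).natDegree) (Finset.mem_univ s)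
        have h2 := Finset.le_sup
          (f := fun f : Finset (Fin n) → N => Finset.univ.sup fun s => (f s : R[X]).natDegree) hf
        exact_mod_cast h1.trans h2
      · rfl
    | zero => exact ⟨0, by simp⟩
    | add f g _ _ hf hg =>
      obtain ⟨w, hw⟩ := hf
      obtain ⟨w', hw'⟩ := hg
      exact ⟨w + w', by rw [map_add, map_add, map_add, hw, hw']⟩
    | smul c f hfT hf =>
      obtain ⟨w, hw⟩ := hf
      rw [hT] at hfT
      obtain ⟨w', hw'⟩ := smul_mem_range_koszulDifferential y
        (hspan ▸ sub_algebraMap_mem_reesIrrelevant c) hfT.1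
      refine ⟨(c : R[X]).coeff 0 • w + w', ?_⟩
      have hd : koszulDifferential N y ((c : R[X]).coeff 0 • w) =
          (c : R[X]).coeff 0 • koszulDifferential N y w :=
        ((koszulDifferential N y).restrictScalars R).map_smul _ _
      have hc : c • f = (c : R[X]).coeff 0 • f +
          (c - algebraMap R (reesAlgebra 𝔪) ((c : R[X]).coeff 0)) • f :=
        funext fun s => smul_eq_smul_add_sub_smul _ c (f s)
      rw [hc, map_add, map_add, map_add, hd, LinearMap.map_smul (chainProj hN n i j), hw,
        LinearMap.map_smul (chainProj hN n i j), hw']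
  intro f hf
  obtain ⟨hfc, hfd⟩ := hf
  obtain ⟨w, hw⟩ := key f ⟨hfd, fun s hs => (hfc s).2 hs⟩
  refine ⟨chainProj hN n (i + 1) j w, chainProj_mem _ _ _ _, ?_⟩
  rw [chainProj_eq_self hN hfc, chainProj_koszulDifferential hN hy] at hw
  exact hw.symm

theorem koszulCycles_eq_bot {y : Fin n → reesAlgebra 𝔪} {i : ℕ} (hi : n < i) (j : ℤ) :
    koszulCycles (M := N) (component N) y i j = ⊥ := by
  rw [eq_bot_iff]
  intro f hf
  rw [Submodule.mem_bot]
  funext s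
  refine (hf.1 s).2 fun h => ?_
  have := s.card_le_univ
  rw [Fintype.card_fin] at this
  omega

/-- The Koszul homology of a finitely generated graded module lives in bounded degrees. -/
theorem exists_forall_koszulCycles_le_of_lt [IsNoetherianRing R] (hN : IsGraded N)
    [IsNoetherian (reesAlgebra 𝔪) N] {y : Fin n → reesAlgebra 𝔪} (hy : ∀ a, IsDegreeOne (y a))
    (hspan : Ideal.span (Set.range y) = reesIrrelevant 𝔪) :
    ∃ D : ℕ, ∀ (i : ℕ) (j : ℤ), D < j - i →
      koszulCycles (M := N) (component N) y i j ≤ koszulBoundaries (M := N) (component N) y i j := by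
  choose D hD using exists_forall_koszulCycles_le hN hy hspan
  refine ⟨(Finset.range (n + 1)).sup D, fun i j hj => ?_⟩
  by_cases hi : n < i
  · rw [koszulCycles_eq_bot hi]; exact bot_le
  · refine hD i j (lt_of_le_of_lt ?_ hj)
    exact_mod_cast Finset.le_sup (f := D) (Finset.mem_range.mpr (by omega))

/-- The zeroth Koszul homology of a non-zero graded module does not vanish in the initial
degree. -/
theorem exists_nontrivial_koszulHomology (hN : IsGraded N) (hN0 : N ≠ ⊥)
    (y : Fin n → reesAlgebra 𝔪) :
    ∃ j : ℤ, Nontrivial (koszulHomology (M := N) (component N) y 0 j) := by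
  classical
  have hex : ∃ k, ∃ f ∈ N, f.coeff k ≠ 0 := by
    obtain ⟨f, hf, h0⟩ := N.ne_bot_iff.mp hN0
    by_contra! h
    exact h0 (Polynomial.ext fun k => h k f hf)
  let k := Nat.find hex
  obtain ⟨f, hf, hfk⟩ := Nat.find_spec hex
  have hmin : ∀ l : ℕ, l < k → ∀ g ∈ N, g.coeff l = 0 := fun l hl g hg => by
    have := Nat.find_min hex hl
    push Not at this
    exact this g hg
  refine ⟨k, (nontrivial_koszulHomology_iff _ y 0 k).mpr fun hle => hfk ?_⟩
  let m : N := ⟨monomial k (f.coeff k), hN f hf k⟩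
  have hm : m ∈ component N (k : ℤ) := fun l hl =>
    coeff_monomial_of_ne _ (by exact_mod_cast hl)
  let g : Finset (Fin n) → N := fun s => if s = ∅ then m else 0
  have hg : g ∈ koszulCycles (M := N) (component N) y 0 (k : ℤ) := by
    refine ⟨fun s => ⟨fun h => ?_, fun h => ?_⟩, ?_⟩
    · simp only [g, if_pos (Finset.card_eq_zero.mp h)]
      simpa using hm
    · exact if_neg fun e => h (Finset.card_eq_zero.mpr e)
    · funext t
      exact Finset.sum_eq_zero fun a _ => by
        simp only [g, if_neg (Finset.insert_ne_empty a t), smul_zero]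
  obtain ⟨w, hw, hwg⟩ := hle hg
  -- A 1-chain of internal degree `k` has coefficients in degree `k - 1`, below the initial degree
  -- of `N`.
  have hw0 : w = 0 := by
    funext s
    by_cases hs : s.card = 0 + 1
    · ext l
      by_cases hl : (l : ℤ) = k - (0 + 1 : ℕ)
      · rw [hmin l (by push_cast at hl; omega) _ (w s).2]; simp
      · rw [(hw s).1 hs l hl]; simp
    · exact (hw s).2 hs
  rw [hw0, map_zero] at hwg
  have := congrArg (fun h : N => (h : R[X]).coeff k) (congrFun hwg ∅)
  simpa [g, m, k] using this.symm

/-- The Castelnuovo--Mumford regularity of a non-zero finitely generated graded module exists. -/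
theorem exists_isRegularity [IsNoetherianRing R] (hN : IsGraded N) (hN0 : N ≠ ⊥)
    [IsNoetherian (reesAlgebra 𝔪) N] {y : Fin n → reesAlgebra 𝔪} (hy : ∀ a, IsDegreeOne (y a))
    (hspan : Ideal.span (Set.range y) = reesIrrelevant 𝔪) :
    ∃ r : ℤ, IsRegularity (M := N) (component N) y r := by
  obtain ⟨D, hD⟩ := exists_forall_koszulCycles_le_of_lt hN hy hspan
  obtain ⟨j, hj⟩ := exists_nontrivial_koszulHomology hN hN0 y
  have hne : {e : ℤ | ∃ (i : ℕ) (j : ℤ), Nontrivial (koszulHomology (M := N) (component N) y i j) ∧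
      e = j - i}.Nonempty := ⟨j - (0 : ℕ), 0, j, hj, rfl⟩
  have hbdd : BddAbove {e : ℤ | ∃ (i : ℕ) (j : ℤ),
      Nontrivial (koszulHomology (M := N) (component N) y i j) ∧ e = j - i} := by
    refine ⟨D, ?_⟩
    rintro e ⟨i, j, hij, rfl⟩
    by_contra! h
    exact (nontrivial_koszulHomology_iff _ y i j).mp hij (hD i j h)
  exact ⟨_, Int.csSup_mem hne hbdd, fun e he => le_csSup hbdd he⟩

/-- If `H₀(y; N)_{k + 1} = 0`, then `N_{k + 1} = 𝔪 N_k`. -/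
theorem coeff_succ_mem_of_koszulCycles_le {y : Fin n → reesAlgebra 𝔪}
    (hN : IsGraded N) (hy : ∀ a, IsDegreeOne (y a)) {k : ℕ}
    (h : koszulCycles (M := N) (component N) y 0 ((k + 1 : ℕ) : ℤ) ≤
      koszulBoundaries (M := N) (component N) y 0 ((k + 1 : ℕ) : ℤ))
    {J : Ideal R} (hJ : ∀ g ∈ N, g.coeff k ∈ J) {f : R[X]} (hf : f ∈ N) :
    f.coeff (k + 1) ∈ 𝔪 * J := by
  classical
  let m : N := ⟨monomial (k + 1) (f.coeff (k + 1)), hN f hf (k + 1)⟩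
  let g : Finset (Fin n) → N := fun s => if s = ∅ then m else 0
  have hg : g ∈ koszulCycles (M := N) (component N) y 0 ((k + 1 : ℕ) : ℤ) := by
    refine ⟨fun s => ⟨fun h => ?_, fun h => ?_⟩, ?_⟩
    · simp only [g, if_pos (Finset.card_eq_zero.mp h)]
      exact fun l hl => coeff_monomial_of_ne _ fun e => hl (by rw [e]; simp)
    · exact if_neg fun e => h (Finset.card_eq_zero.mpr e)
    · funext t
      exact Finset.sum_eq_zero fun a _ => by
        simp only [g, if_neg (Finset.insert_ne_empty a t), smul_zero]
  obtain ⟨w, hw, hwg⟩ := h hg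
  have h1 := congrArg (fun h : N => (h : R[X]).coeff (k + 1)) (congrFun hwg ∅)
  simp only [g, m, if_true, coeff_monomial_same] at h1
  rw [← h1]
  have h2 : ∀ v : N, ((v : N) : R[X]).coeff (k + 1) = lcoeff R (k + 1) (N.subtype v) :=
    fun _ => rfl
  -- At `∅` a boundary is `∑ y_a w({a})`, and the coefficient of `y_a` in degree one lies in `𝔪`.
  simp only [LinearMap.coe_restrictScalars, koszulDifferential, LinearMap.coe_mk, AddHom.coe_mk]
  rw [h2, map_sum, map_sum]
  refine Ideal.sum_mem _ fun a _ => ?_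
  rw [← h2]
  simp only [Finset.filter_empty, Finset.card_empty, pow_zero, one_mul]
  rw [(hy a).coeff_smul_succ]
  exact Ideal.mul_mem_mul (by simpa using (y a).2 1) (hJ _ (w _).2)

end Regularity

/-! ### The two Rees modules and the bound for the third Dao number -/

section ReesModules

variable {R : Type u} [CommRing R] {𝔪 I : Ideal R}

/-- Multiplication by `c` embeds `N` in the Noetherian ring `ℛ(𝔪)`. It is used with `c = 1` for
`ℛ(𝔪, I)` and with `c` a nonzerodivisor of `𝔪` for the colon module. -/
theorem isNoetherian_of_mul_mem_reesAlgebra [IsNoetherianRing R]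
    {N : Submodule (reesAlgebra 𝔪) R[X]} (c : R[X]) (hc : ∀ f ∈ N, c * f ∈ reesAlgebra 𝔪)
    (hinj : ∀ f g, c * f = c * g → f = g) : IsNoetherian (reesAlgebra 𝔪) N := by
  let φ : N →ₗ[reesAlgebra 𝔪] reesAlgebra 𝔪 :=
    { toFun := fun f => ⟨c * f, hc f f.2⟩
      map_add' := fun f g => Subtype.ext (mul_add c (f : R[X]) g)
      map_smul' := fun r f => Subtype.ext (mul_left_comm c (r : R[X]) f) }
  exact isNoetherian_of_injective φ fun f g h =>
    Subtype.ext (hinj f g (congrArg Subtype.val h))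

theorem isNoetherian_reesModule [IsNoetherianRing R] :
    IsNoetherian (reesAlgebra 𝔪) (reesModule 𝔪 I) := by
  refine isNoetherian_of_mul_mem_reesAlgebra (N := reesModule 𝔪 I) 1 (fun f hf => ?_)
    (fun f g h => ?_)
  · rw [one_mul, mem_reesAlgebra_iff]
    intro k
    have hk : f.coeff k ∈ I * 𝔪 ^ k := hf k
    exact (Ideal.mul_le_right : I * 𝔪 ^ k ≤ 𝔪 ^ k) hk
  · rwa [one_mul, one_mul] at h

theorem isGraded_reesModule : IsGraded (reesModule 𝔪 I) := fun f hf k l => by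
  rw [coeff_monomial]
  split_ifs with h
  · exact h ▸ hf k
  · exact zero_mem _

/-- Truncation forces `𝔪` to kill the constant coefficient, which therefore vanishes because `z ∈ 𝔪`
is a nonzerodivisor. -/
theorem mem_reesColon_iff {z : R} (hz : z ∈ 𝔪) (hz0 : ∀ y, z * y = 0 → y = 0) {f : R[X]} :
    f ∈ reesColon 𝔪 I ↔
      f.coeff 0 = 0 ∧ ∀ k : ℕ, f.coeff (k + 1) ∈ (I * 𝔪 ^ (k + 1)).colon (𝔪 : Set R) := by
  constructor
  · intro hf
    refine ⟨hz0 _ ?_, fun k => Submodule.mem_colon.mpr fun c hc => ?_⟩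
    · have := (hf (C z) ⟨z, hz, rfl⟩).2
      rwa [coeff_C_mul] at this
    · have := (hf (C c) ⟨c, hc, rfl⟩).1 (k + 1)
      rwa [coeff_C_mul, mul_comm c] at this
  · rintro ⟨h0, hf⟩ _ ⟨c, hc, rfl⟩
    refine ⟨fun k => ?_, by rw [coeff_C_mul, h0, mul_zero]⟩
    rw [coeff_C_mul]
    cases k with
    | zero => rw [h0, mul_zero]; exact zero_mem _
    | succ k => rw [mul_comm c]; exact Submodule.mem_colon.mp (hf k) c hc

theorem reesColon_eq_polynomialColon {z : R} (hz : z ∈ 𝔪) (hz0 : ∀ y, z * y = 0 → y = 0) :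
    reesColon 𝔪 I = polynomialColon (truncation (reesModule 𝔪 I)) (reesModule 𝔪 𝔪) := by
  ext f
  constructor
  · intro hf g hg
    obtain ⟨h0, h1⟩ := (mem_reesColon_iff hz hz0).mp hf
    refine ⟨fun k => ?_, by rw [mul_coeff_zero, h0, mul_zero]⟩
    rw [coeff_mul]
    refine Ideal.sum_mem _ fun p hp => ?_
    rw [← Finset.HasAntidiagonal.mem_antidiagonal.mp hp]
    rcases p with ⟨i, l⟩
    cases l with
    | zero => rw [h0, mul_zero]; exact zero_mem _
    | succ l =>
      have hle : (𝔪 * 𝔪 ^ i) * (I * 𝔪 ^ (l + 1)).colon (𝔪 : Set R) ≤ I * 𝔪 ^ (i + (l + 1)) := by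
        have : 𝔪 * (I * 𝔪 ^ (l + 1)).colon (𝔪 : Set R) ≤ I * 𝔪 ^ (l + 1) :=
          Ideal.mul_le.mpr fun c hc b hb => by
            rw [mul_comm c]; exact Submodule.mem_colon.mp hb c hc
        calc _ = 𝔪 ^ i * (𝔪 * (I * 𝔪 ^ (l + 1)).colon (𝔪 : Set R)) := by
              rw [mul_comm 𝔪, mul_assoc]
          _ ≤ 𝔪 ^ i * (I * 𝔪 ^ (l + 1)) := Ideal.mul_mono_right this
          _ = _ := by rw [pow_add 𝔪 i, mul_left_comm]
      exact hle (Ideal.mul_mem_mul (hg i) (h1 l))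
  · rintro hf _ ⟨c, hc, rfl⟩
    refine hf _ fun k => ?_
    rw [coeff_C]
    split_ifs with h
    · simpa [h] using hc
    · exact zero_mem _

theorem isNoetherian_reesColon [IsNoetherianRing R] {z : R} (hz : z ∈ 𝔪)
    (hz0 : ∀ y, z * y = 0 → y = 0) : IsNoetherian (reesAlgebra 𝔪) (reesColon 𝔪 I) := by
  refine isNoetherian_of_mul_mem_reesAlgebra (N := reesColon 𝔪 I) (C z) (fun f hf => ?_)
    (fun f g h => Polynomial.ext fun k => sub_eq_zero.mp (hz0 _ ?_))
  · rw [mem_reesAlgebra_iff]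
    intro k
    have hk : (C z * f).coeff k ∈ I * 𝔪 ^ k := (hf (C z) ⟨z, hz, rfl⟩).1 k
    exact (Ideal.mul_le_right : I * 𝔪 ^ k ≤ 𝔪 ^ k) hk
  · rw [mul_sub, ← coeff_C_mul, ← coeff_C_mul, h, sub_self]

theorem isGraded_reesColon : IsGraded (reesColon 𝔪 I) := by
  rintro f hf k _ ⟨c, hc, rfl⟩
  obtain ⟨h1, h2⟩ := hf (C c) ⟨c, hc, rfl⟩
  refine ⟨fun l => ?_, ?_⟩
  · rw [coeff_C_mul, coeff_monomial]
    split_ifs with h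
    · rw [← coeff_C_mul, h]; exact h1 l
    · rw [mul_zero]; exact zero_mem _
  · rw [coeff_C_mul, coeff_monomial]
    split_ifs with h
    · rw [← coeff_C_mul, h]; exact h2
    · rw [mul_zero]

theorem reesModule_ne_bot (hI : I ≠ ⊥) : reesModule 𝔪 I ≠ ⊥ := by
  obtain ⟨a, ha, h0⟩ := I.ne_bot_iff.mp hI
  refine (Submodule.ne_bot_iff _).mpr ⟨C a, fun k => ?_, by simpa using h0⟩
  rw [coeff_C]
  split_ifs with h
  · simpa [h] using ha
  · exact zero_mem _

theorem monomial_one_mem_reesColon {a : R} (ha : a ∈ I) : monomial 1 a ∈ reesColon 𝔪 I := by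
  rintro _ ⟨c, hc, rfl⟩
  rw [C_mul_monomial]
  refine ⟨fun k => ?_, coeff_monomial_of_ne _ (by simp)⟩
  rw [coeff_monomial]
  split_ifs with h
  · rw [← h, pow_one, mul_comm c]; exact Ideal.mul_mem_mul ha hc
  · exact zero_mem _

theorem reesColon_ne_bot (hI : I ≠ ⊥) : reesColon 𝔪 I ≠ ⊥ := by
  obtain ⟨a, ha, h0⟩ := I.ne_bot_iff.mp hI
  exact (Submodule.ne_bot_iff _).mpr ⟨_, monomial_one_mem_reesColon ha, by simpa using h0⟩

theorem le_colon_mul : I ≤ (I * 𝔪).colon (𝔪 : Set R) := fun _ ha =>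
  Submodule.mem_colon.mpr fun _ hc => Ideal.mul_mem_mul ha hc

variable {n : ℕ} {y : Fin n → reesAlgebra 𝔪}

/-- `I𝔪ᵏ` is weakly `𝔪`-full as soon as `H₀(y; ℛ(𝔪, I)_{≥ 1} : 𝔪)_{k + 1} = 0` and `k ≥ 1`. -/
theorem isWeaklyMFull_of_koszulCycles_le {z : R} (hz : z ∈ 𝔪) (hz0 : ∀ y, z * y = 0 → y = 0)
    (hy : ∀ a, IsDegreeOne (y a)) {k : ℕ} (hk : 1 ≤ k)
    (h : koszulCycles (M := reesColon 𝔪 I) (component (reesColon 𝔪 I)) y 0 ((k + 1 : ℕ) : ℤ) ≤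
      koszulBoundaries (M := reesColon 𝔪 I) (component (reesColon 𝔪 I)) y 0 ((k + 1 : ℕ) : ℤ)) :
    IsWeaklyMFull 𝔪 (I * 𝔪 ^ k) := by
  refine le_antisymm (fun a ha => ?_) le_colon_mul
  rw [mul_assoc, ← pow_succ] at ha
  have hf : monomial (k + 1) a ∈ reesColon 𝔪 I := by
    refine (mem_reesColon_iff hz hz0).mpr ⟨coeff_monomial_of_ne _ (by simp), fun l => ?_⟩
    rw [coeff_monomial]
    split_ifs with h
    · rwa [← h]
    · exact zero_mem _
  have := coeff_succ_mem_of_koszulCycles_le isGraded_reesColon hy h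
    (J := (I * 𝔪 ^ k).colon (𝔪 : Set R)) (fun g hg => by
      obtain ⟨l, rfl⟩ := Nat.exists_eq_add_of_le' hk
      exact ((mem_reesColon_iff hz hz0).mp hg).2 l) hf
  rw [coeff_monomial_same] at this
  have hle : 𝔪 * (I * 𝔪 ^ k).colon (𝔪 : Set R) ≤ I * 𝔪 ^ k :=
    Ideal.mul_le.mpr fun c hc b hb => by
      rw [mul_comm c]; exact Submodule.mem_colon.mp hb c hc
  exact hle this

/-- Otherwise `H₀` vanishes in degree one, so the component of degree one is `𝔪` times the zero
component of degree zero; but it contains `I`. -/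
theorem one_le_of_isRegularity_reesColon {z : R} (hz : z ∈ 𝔪) (hz0 : ∀ y, z * y = 0 → y = 0)
    (hI : I ≠ ⊥) (hy : ∀ a, IsDegreeOne (y a)) {r : ℤ}
    (hr : IsRegularity (M := reesColon 𝔪 I) (component (reesColon 𝔪 I)) y r) : 1 ≤ r := by
  by_contra! h
  obtain ⟨a, ha, h0⟩ := I.ne_bot_iff.mp hI
  have hle : koszulCycles (M := reesColon 𝔪 I) (component (reesColon 𝔪 I)) y 0 ((0 + 1 : ℕ) : ℤ) ≤
      koszulBoundaries (M := reesColon 𝔪 I) (component (reesColon 𝔪 I)) y 0 ((0 + 1 : ℕ) : ℤ) := by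
    by_contra hn
    have := hr.2 ⟨0, _, (nontrivial_koszulHomology_iff _ y _ _).mpr hn, rfl⟩
    push_cast at this
    omega
  have := coeff_succ_mem_of_koszulCycles_le isGraded_reesColon hy hle (J := ⊥)
    (fun g hg => ((mem_reesColon_iff hz hz0).mp hg).1) (monomial_one_mem_reesColon ha)
  rw [zero_add, coeff_monomial_same, Ideal.mul_bot] at this
  exact h0 this

/-- The regularity of `ℛ(𝔪, I)_{≥ 1} : 𝔪` bounds the third Dao number. -/
theorem toNat_mem_daoSet₃_of_isRegularity {z : R} (hz : z ∈ 𝔪) (hz0 : ∀ y, z * y = 0 → y = 0)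
    (hI : I ≠ ⊥) (hy : ∀ a, IsDegreeOne (y a)) {r : ℤ}
    (hr : IsRegularity (M := reesColon 𝔪 I) (component (reesColon 𝔪 I)) y r) :
    r.toNat ∈ daoSet₃ 𝔪 I := by
  have h1 := one_le_of_isRegularity_reesColon hz hz0 hI hy hr
  intro k hk
  refine isWeaklyMFull_of_koszulCycles_le hz hz0 hy (by omega) ?_
  by_contra hn
  have := hr.2 ⟨0, _, (nontrivial_koszulHomology_iff _ y _ _).mpr hn, rfl⟩
  push_cast at this
  omega

theorem mem_reesIrrelevant {f : reesAlgebra 𝔪} : f ∈ reesIrrelevant 𝔪 ↔ (f : R[X]).coeff 0 = 0 :=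
  Iff.rfl

/-- The element `x t` of the Rees algebra. -/
def degreeOne (x : 𝔪) : reesAlgebra 𝔪 :=
  ⟨monomial 1 (x : R), reesAlgebra.monomial_mem.mpr (by simp)⟩

theorem isDegreeOne_degreeOne (x : 𝔪) : IsDegreeOne (degreeOne x) := fun _ hk =>
  coeff_monomial_of_ne _ hk

theorem degreeOne_mem_reesIrrelevant (x : 𝔪) : degreeOne x ∈ reesIrrelevant 𝔪 :=
  coeff_monomial_of_ne _ (by simp)

/-- The irrelevant ideal is generated by the elements `x t` with `x ∈ 𝔪`. -/
theorem reesIrrelevant_le {P : Ideal (reesAlgebra 𝔪)} (hP : ∀ x : 𝔪, degreeOne x ∈ P) :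
    reesIrrelevant 𝔪 ≤ P := by
  have key : ∀ (k : ℕ) (a : R) (ha : a ∈ 𝔪 ^ (k + 1)),
      (⟨monomial (k + 1) a, reesAlgebra.monomial_mem.mpr ha⟩ : reesAlgebra 𝔪) ∈ P := by
    intro k a ha
    rw [pow_succ] at ha
    induction ha using Submodule.mul_induction_on' with
    | mem_mul_mem b hb x hx =>
      convert P.mul_mem_left ⟨monomial k b, reesAlgebra.monomial_mem.mpr hb⟩ (hP ⟨x, hx⟩) using 1
      exact Subtype.ext (by simp [degreeOne, monomial_mul_monomial])
    | add b hb c hc h1 h2 =>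
      convert P.add_mem (h1 (by rwa [pow_succ])) (h2 (by rwa [pow_succ])) using 1
      exact Subtype.ext (by simp)
  intro f hf
  have hsum : f = ∑ k ∈ (f : R[X]).support,
      ⟨monomial k ((f : R[X]).coeff k), reesAlgebra.monomial_mem.mpr (f.2 k)⟩ := by
    apply Subtype.ext
    rw [AddSubmonoidClass.coe_finsetSum]
    exact (f : R[X]).as_sum_support
  rw [hsum]
  refine Ideal.sum_mem _ fun k hk => ?_
  cases k with
  | zero => exact absurd (mem_reesIrrelevant.mp hf) (mem_support_iff.mp hk)
  | succ k => exact key k _ ((f : reesAlgebra 𝔪).2 (k + 1))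

/-- Existence of the third Dao number needs only some generators of degree one, minimal or not. -/
theorem exists_degreeOne_generators [IsNoetherianRing R] (𝔪 : Ideal R) :
    ∃ (n : ℕ) (y : Fin n → reesAlgebra 𝔪), (∀ a, IsDegreeOne (y a)) ∧
      Ideal.span (Set.range y) = reesIrrelevant 𝔪 := by
  obtain ⟨n, x, hx⟩ := Submodule.fg_iff_exists_fin_generating_family.mp
    (IsNoetherian.noetherian (⊤ : Submodule R 𝔪))
  refine ⟨n, fun a => degreeOne (x a), fun a => isDegreeOne_degreeOne _, le_antisymm ?_ ?_⟩
  · rw [Ideal.span_le]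
    rintro _ ⟨a, rfl⟩
    exact degreeOne_mem_reesIrrelevant _
  · refine reesIrrelevant_le fun w => ?_
    have hw : w ∈ Submodule.span R (Set.range x) := hx ▸ Submodule.mem_top
    induction hw using Submodule.span_induction with
    | mem w hw =>
      obtain ⟨a, rfl⟩ := hw
      exact Ideal.subset_span ⟨a, rfl⟩
    | zero =>
      convert (Ideal.span _).zero_mem using 1
      exact Subtype.ext (by simp [degreeOne])
    | add v w _ _ hv hw =>
      convert add_mem hv hw using 1
      exact Subtype.ext (by simp [degreeOne])
    | smul c w _ hw =>
      convert Ideal.mul_mem_left _ (algebraMap R (reesAlgebra 𝔪) c) hw using 1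
      exact Subtype.ext (by simp [degreeOne])

/-- Minimal homogeneous generators of the irrelevant ideal have degree one. -/
theorem IsMinimalHomogeneousGenerators.isDegreeOne (hy : IsMinimalHomogeneousGenerators 𝔪 y)
    (a : Fin n) : IsDegreeOne (y a) := by
  by_contra ha
  refine hy.minimal a (le_antisymm ?_ (reesIrrelevant_le fun x => ?_))
  · rw [← hy.span_eq]
    exact Ideal.span_mono (Set.image_subset_range _ _)
  have hmem : degreeOne x ∈ Ideal.span (Set.range y) := hy.span_eq ▸ degreeOne_mem_reesIrrelevant x
  obtain ⟨c, hc⟩ := (Ideal.mem_span_range_iff_exists_fun).mp hmem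
  have h0 : ∀ b, (y b : R[X]).coeff 0 = 0 := fun b =>
    mem_reesIrrelevant.mp (hy.span_eq ▸ Ideal.subset_span ⟨b, rfl⟩)
  have ha1 : (y a : R[X]).coeff 1 = 0 := by
    obtain ⟨d, hd⟩ := hy.homogeneous a
    by_contra h
    obtain rfl : d = 1 := by_contra fun e => h (hd 1 (Ne.symm e))
    exact ha hd
  -- The `y_b` have no constant term, so in degree one only the constant terms of the `c_b`
  -- contribute. The summand of `y_a` is zero, which makes `y_a` superfluous.
  have hx : degreeOne x = ∑ b, algebraMap R (reesAlgebra 𝔪) ((c b : R[X]).coeff 0) *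
      (⟨monomial 1 ((y b : R[X]).coeff 1), reesAlgebra.monomial_mem.mpr ((y b).2 1)⟩) := by
    apply Subtype.ext
    have h1 := congrArg (fun f : reesAlgebra 𝔪 => (f : R[X]).coeff 1) hc
    simp only [AddSubmonoidClass.coe_finsetSum, MulMemClass.coe_mul, finsetSum_coeff, degreeOne,
      coeff_monomial_same, Subalgebra.coe_algebraMap, Polynomial.algebraMap_apply,
      Algebra.algebraMap_self, RingHom.id_apply, C_mul_monomial] at h1 ⊢
    rw [← h1, map_sum]
    refine Finset.sum_congr rfl fun b _ => ?_
    rw [mul_coeff_one, h0, mul_zero, add_zero]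
  rw [hx]
  refine Ideal.sum_mem _ fun b _ => Ideal.mul_mem_left _ _ ?_
  by_cases hb : (y b : R[X]).coeff 1 = 0
  · convert (Ideal.span _).zero_mem using 1
    exact Subtype.ext (by simp [hb])
  · have hbd : IsDegreeOne (y b) := by
      obtain ⟨d, hd⟩ := hy.homogeneous b
      obtain rfl : d = 1 := by_contra fun e => hb (hd 1 (Ne.symm e))
      exact hd
    have hba : b ∈ ({a}ᶜ : Set (Fin n)) := fun e => hb (by rw [Set.mem_singleton_iff.mp e, ha1])
    have hyb : y b ∈ Ideal.span (y '' {a}ᶜ) := Ideal.subset_span (Set.mem_image_of_mem y hba)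
    convert hyb using 1
    exact Subtype.ext hbd.eq_monomial.symm

/-- The third Dao number exists. -/
theorem daoSet₃_nonempty [IsNoetherianRing R] {z : R} (hz : z ∈ 𝔪)
    (hz0 : ∀ y, z * y = 0 → y = 0) (I : Ideal R) : (daoSet₃ 𝔪 I).Nonempty := by
  obtain ⟨n, y, hy, hspan⟩ := exists_degreeOne_generators 𝔪
  have := isNoetherian_reesColon (I := I) hz hz0
  obtain ⟨D, hD⟩ := exists_forall_koszulCycles_le_of_lt (isGraded_reesColon (I := I)) hy hspan
  refine ⟨D + 1, fun k hk => isWeaklyMFull_of_koszulCycles_le hz hz0 hy (by omega) (hD _ _ ?_)⟩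
  push_cast
  omega

end ReesModules

/-! ### Non-empty Zariski open sets over an infinite field -/

section ZariskiTopology

variable {K V : Type*} [Field K] [AddCommGroup V] [Module K V]

theorem isZariskiOpen_ne_zero (T : Finset (Module.Dual K V)) :
    IsZariskiOpen K {v : V | ∀ φ ∈ T, φ v ≠ 0} := by
  refine ⟨{∏ φ ∈ T, (φ : V → K)}, ?_, ?_⟩
  · rw [Set.singleton_subset_iff]
    exact Subalgebra.prod_mem _ fun φ _ => Algebra.subset_adjoin ⟨φ, rfl⟩
  · ext v
    simp [Finset.prod_apply, Finset.prod_ne_zero_iff]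

theorem nonempty_ne_zero [Infinite K] (T : Finset (Module.Dual K V)) (hT : ∀ φ ∈ T, φ ≠ 0) :
    {v : V | ∀ φ ∈ T, φ v ≠ 0}.Nonempty := by
  classical
  have h := Subspace.biUnion_ne_univ_of_top_notMem (s := T.image fun φ => LinearMap.ker φ) (by
    intro h
    obtain ⟨φ, hφ, hk⟩ := Finset.mem_image.mp h
    exact hT φ hφ (LinearMap.ker_eq_top.mp hk))
  obtain ⟨v, hv⟩ := (Set.ne_univ_iff_exists_notMem _).mp h
  refine ⟨v, fun φ hφ h0 => hv ?_⟩
  simp only [Set.mem_iUnion]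
  exact ⟨_, Finset.mem_image_of_mem _ hφ, h0⟩

/-- A non-empty Zariski open subset of a non-zero vector space over an infinite field contains a
non-zero vector. -/
theorem IsZariskiOpen.exists_ne_zero [Infinite K] [Nontrivial V] {U : Set V}
    (hU : IsZariskiOpen K U) (hne : U.Nonempty) : ∃ v ∈ U, v ≠ 0 := by
  obtain ⟨S, hS, rfl⟩ := hU
  obtain ⟨v, f, hf, hv⟩ := hne
  by_cases h0 : v = 0
  swap
  · exact ⟨v, ⟨f, hf, hv⟩, h0⟩
  obtain ⟨e, he⟩ := exists_ne (0 : V)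
  have key : ∀ g ∈ polynomialFunctions K V, ∃ p : K[X], ∀ t : K, g (t • e) = p.eval t := by
    intro g hg
    induction hg using Algebra.adjoin_induction with
    | mem g hg =>
      obtain ⟨φ, rfl⟩ := hg
      exact ⟨C (φ e) * X, fun t => by
        change φ (t • e) = _
        rw [map_smul, smul_eq_mul, eval_mul, eval_C, eval_X, mul_comm]⟩
    | algebraMap r => exact ⟨C r, fun t => by rw [eval_C]; rfl⟩
    | add g h _ _ hg hh =>
      obtain ⟨p, hp⟩ := hg
      obtain ⟨q, hq⟩ := hh
      exact ⟨p + q, fun t => by simp [hp, hq]⟩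
    | mul g h _ _ hg hh =>
      obtain ⟨p, hp⟩ := hg
      obtain ⟨q, hq⟩ := hh
      exact ⟨p * q, fun t => by simp [hp, hq]⟩
  obtain ⟨p, hp⟩ := key f (hS hf)
  -- On the line through `e` the function `f` is a polynomial `p` with `p(0) ≠ 0`; the factor `X`
  -- makes the non-root `t` different from zero.
  have hp0 : X * p ≠ 0 := by
    refine mul_ne_zero X_ne_zero fun h => hv ?_
    rw [h0, ← zero_smul K e, hp, h, eval_zero]
  obtain ⟨t, ht⟩ := Polynomial.exists_eval_ne_zero_of_natDegree_lt_card (X * p) hp0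
    (Cardinal.natCast_lt_aleph0.trans_le (Cardinal.aleph0_le_mk K))
  rw [eval_mul, eval_X] at ht
  exact ⟨t • e, ⟨f, hf, by rw [hp]; exact right_ne_zero_of_mul ht⟩,
    smul_ne_zero (left_ne_zero_of_mul ht) he⟩

end ZariskiTopology

/-! ### Associated primes and torsion -/

section AssociatedPrimes

/-- Outside finitely many primes `(𝔞 : s)` not containing `Q`, the annihilator of `u` on `S ⧸ 𝔞`
is `Q`-torsion. -/
theorem exists_finset_prime_forall_pow_mul_mem {S : Type*} [CommRing S] [IsNoetherianRing S]
    (𝔞 Q : Ideal S) :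
    ∃ T : Finset (Ideal S), (∀ P ∈ T, P.IsPrime ∧ ¬ Q ≤ P ∧ ∃ s, ∀ r, r ∈ P ↔ r * s ∈ 𝔞) ∧
      ∀ u s, u * s ∈ 𝔞 → (∀ P ∈ T, u ∉ P) → ∃ c : ℕ, ∀ q ∈ Q ^ c, q * s ∈ 𝔞 := by
  classical
  have hfin : (associatedPrimes S (S ⧸ 𝔞)).Finite := associatedPrimes.finite S (S ⧸ 𝔞)
  have hmem : ∀ r s : S, r • Ideal.Quotient.mk 𝔞 s = 0 ↔ r * s ∈ 𝔞 := fun r s =>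
    Submodule.Quotient.mk_eq_zero (x := r • s) 𝔞
  refine ⟨hfin.toFinset.filter fun P => ¬ Q ≤ P, fun P hP => ?_, fun u s hus hu => ?_⟩
  · obtain ⟨hP, hQ⟩ := Finset.mem_filter.mp hP
    obtain ⟨hprime, a, rfl⟩ := isAssociatedPrime_iff.mp (hfin.mem_toFinset.mp hP)
    obtain ⟨s, rfl⟩ := Ideal.Quotient.mk_surjective a
    exact ⟨hprime, hQ, s, fun r => by rw [Submodule.mem_colon_singleton, Submodule.mem_bot, hmem]⟩
  · let a := Ideal.Quotient.mk 𝔞 s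
    have hua : u ∈ Module.annihilator S (Submodule.span S {a}) :=
      (Submodule.mem_annihilator_span_singleton a _).mpr ((hmem u s).mpr hus)
    -- Minimal primes of the annihilator of `s` are associated to `S ⧸ 𝔞` and contain `u`; those
    -- missing `Q` would belong to `T`, which `u` avoids.
    have hrad : Q ≤ (Module.annihilator S (Submodule.span S {a})).radical := by
      rw [← Ideal.sInf_minimalPrimes]
      refine le_sInf fun P hP => ?_
      have hass : P ∈ associatedPrimes S (S ⧸ 𝔞) :=
        associatedPrimes.subset_of_injective (Submodule.subtype_injective (Submodule.span S {a}))
          (Module.associatedPrimes.minimalPrimes_annihilator_subset_associatedPrimes S _ hP)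
      by_contra hQ
      exact hu P (Finset.mem_filter.mpr ⟨hfin.mem_toFinset.mpr hass, hQ⟩) (hP.1.2 hua)
    obtain ⟨c, hc⟩ := Ideal.exists_pow_le_of_le_radical_of_fg hrad (IsNoetherian.noetherian _)
    exact ⟨c, fun q hq =>
      (hmem q s).mp ((Submodule.mem_annihilator_span_singleton a q).mp (hc hq))⟩

end AssociatedPrimes

/-! ### Generic elements avoid the relevant associated primes -/

section Superficial

variable {R : Type u} [CommRing R] {𝔪 : Ideal R}

/-- The elements outside `𝔪` act injectively on `R ⧸ J`. -/
def IsSaturatedAt (𝔪 J : Ideal R) : Prop := ∀ r ∉ 𝔪, ∀ y, r * y ∈ J → y ∈ J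

/-- Nakayama's lemma for `𝔪 ⧸ W` without locality: it gives `r ≡ 1` modulo `𝔪` killing the quotient.
-/
theorem exists_notMem_forall_smul_mem [IsNoetherianRing R] (h𝔪 : 𝔪 ≠ ⊤) (W : Submodule R 𝔪)
    (hW : ∀ x : 𝔪, ∃ w ∈ W, 𝔪.toCotangent w = 𝔪.toCotangent x) :
    ∃ r ∉ 𝔪, ∀ x : 𝔪, r • x ∈ W := by
  obtain ⟨r, hr, hrW⟩ := Submodule.exists_sub_one_mem_and_smul_eq_zero_of_fg_of_le_smul 𝔪
    (⊤ : Submodule R (𝔪 ⧸ W)) (IsNoetherian.noetherian _) (fun q _ => by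
      obtain ⟨x, rfl⟩ := W.mkQ_surjective q
      obtain ⟨w, hw, hwx⟩ := hW x
      have h1 : x - w ∈ (𝔪 • ⊤ : Submodule R 𝔪) := by
        have : x - w ∈ LinearMap.ker 𝔪.toCotangent := by
          rw [LinearMap.mem_ker, map_sub, hwx, sub_self]
        exact (Submodule.ker_mkQ (𝔪 • ⊤ : Submodule R 𝔪)).le this
      have h2 : W.mkQ x = W.mkQ (x - w) := by
        rw [map_sub, W.mkQ_apply w, (Submodule.Quotient.mk_eq_zero W).mpr hw, sub_zero]
      rw [h2, ← W.range_mkQ, ← Submodule.map_top, ← Submodule.map_smul'']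
      exact Submodule.mem_map_of_mem h1)
  refine ⟨r, fun h => h𝔪 ((Ideal.eq_top_iff_one _).mpr ?_), fun x => ?_⟩
  · rw [← sub_sub_cancel r 1]
    exact sub_mem h hr
  · rw [← Submodule.Quotient.mk_eq_zero]
    exact hrW (W.mkQ x) trivial

/-- The `x` with `xt ∈ P` span a proper subspace of `𝔪/𝔪²`: otherwise some `r ∉ 𝔪` has `r·xt ∈ P`
for all `x ∈ 𝔪`, and as `r ∉ P`, the prime `P` contains `Q`. -/
theorem exists_dual_of_prime [IsNoetherianRing R] (h𝔪 : 𝔪.IsMaximal) {P : Ideal (reesAlgebra 𝔪)}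
    (hP : P.IsPrime) (hPR : ∀ r : R, algebraMap R (reesAlgebra 𝔪) r ∈ P → r ∈ 𝔪)
    (hQ : ¬ reesIrrelevant 𝔪 ≤ P) :
    ∃ φ : Module.Dual (R ⧸ 𝔪) 𝔪.Cotangent, φ ≠ 0 ∧
      ∀ x : 𝔪, degreeOne x ∈ P → φ (𝔪.toCotangent x) = 0 := by
  let _ := Ideal.Quotient.field 𝔪
  let W : Submodule R 𝔪 :=
    { carrier := {x | degreeOne x ∈ P}
      add_mem' := fun {a b} ha hb => by
        have : degreeOne (a + b) = degreeOne a + degreeOne b :=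
          Subtype.ext (by simp [degreeOne])
        change degreeOne (a + b) ∈ P
        rw [this]
        exact add_mem ha hb
      zero_mem' := by
        have : degreeOne (0 : 𝔪) = 0 := Subtype.ext (by simp [degreeOne])
        change degreeOne (0 : 𝔪) ∈ P
        rw [this]
        exact P.zero_mem
      smul_mem' := fun c x hx => by
        have : degreeOne (c • x) = algebraMap R (reesAlgebra 𝔪) c * degreeOne x :=
          Subtype.ext (by simp [degreeOne])
        change degreeOne (c • x) ∈ P
        rw [this]
        exact P.mul_mem_left _ hx }
  let V : Submodule (R ⧸ 𝔪) 𝔪.Cotangent :=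
    { carrier := (W.map 𝔪.toCotangent : Set 𝔪.Cotangent)
      add_mem' := fun ha hb => (W.map 𝔪.toCotangent).add_mem ha hb
      zero_mem' := (W.map 𝔪.toCotangent).zero_mem
      smul_mem' := fun c v hv => by
        obtain ⟨r, rfl⟩ := Ideal.Quotient.mk_surjective c
        have : Ideal.Quotient.mk 𝔪 r • v = r • v := algebraMap_smul (R ⧸ 𝔪) r v
        rw [this]
        exact (W.map 𝔪.toCotangent).smul_mem r hv }
  have hV : V < ⊤ := by
    rw [lt_top_iff_ne_top]
    intro htop
    obtain ⟨r, hr, hrW⟩ := exists_notMem_forall_smul_mem h𝔪.ne_top W fun x => by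
      have : 𝔪.toCotangent x ∈ V := htop ▸ Submodule.mem_top
      exact this
    refine hQ (reesIrrelevant_le fun x => ?_)
    have h1 : algebraMap R (reesAlgebra 𝔪) r * degreeOne x ∈ P := by
      have h2 : degreeOne (r • x) ∈ P := hrW x
      have : degreeOne (r • x) = algebraMap R (reesAlgebra 𝔪) r * degreeOne x :=
        Subtype.ext (by simp [degreeOne])
      rwa [this] at h2
    exact (hP.mem_or_mem h1).resolve_left fun h => hr (hPR r h)
  obtain ⟨φ, hφ, hφV⟩ := Submodule.exists_le_ker_of_lt_top V hV
  exact ⟨φ, hφ, fun x hx => hφV (show 𝔪.toCotangent x ∈ V from ⟨x, hx, rfl⟩)⟩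

/-- `ℛ(𝔪, I)` as an ideal of `ℛ(𝔪)`. -/
def reesIdeal (𝔪 I : Ideal R) : Ideal (reesAlgebra 𝔪) where
  carrier := {f | (f : R[X]) ∈ reesModule 𝔪 I}
  add_mem' hf hg := (reesModule 𝔪 I).add_mem hf hg
  zero_mem' := (reesModule 𝔪 I).zero_mem
  smul_mem' c _ hf := (reesModule 𝔪 I).smul_mem c hf

theorem mem_reesIdeal {I : Ideal R} {f : reesAlgebra 𝔪} :
    f ∈ reesIdeal 𝔪 I ↔ ∀ k, (f : R[X]).coeff k ∈ I * 𝔪 ^ k := Iff.rfl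

theorem monomial_mem_reesIdeal {I : Ideal R} {k : ℕ} {y : R} (hy : y ∈ 𝔪 ^ k) :
    (⟨monomial k y, reesAlgebra.monomial_mem.mpr hy⟩ : reesAlgebra 𝔪) ∈ reesIdeal 𝔪 I ↔
      y ∈ I * 𝔪 ^ k := by
  rw [mem_reesIdeal]
  constructor
  · intro h
    simpa using h k
  · intro h l
    change (monomial k y).coeff l ∈ _
    rw [coeff_monomial]
    split_ifs with e
    · exact e ▸ h
    · exact zero_mem _

/-- Weak fullness: an element of high degree killed by a power of the irrelevant ideal modulo
`ℛ(𝔪, I)` lies in `ℛ(𝔪, I)`. -/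
theorem mem_mul_pow_of_pow_reesIrrelevant_mul {I : Ideal R} {l : ℕ} (hl : l ∈ daoSet₃ 𝔪 I)
    (c : ℕ) {k : ℕ} (hk : l ≤ k) {y : R} (hy : y ∈ 𝔪 ^ k)
    (h : ∀ q ∈ reesIrrelevant 𝔪 ^ c,
      q * ⟨monomial k y, reesAlgebra.monomial_mem.mpr hy⟩ ∈ reesIdeal 𝔪 I) :
    y ∈ I * 𝔪 ^ k := by
  induction c generalizing k y with
  | zero =>
    have := h 1 (by simp)
    rw [one_mul] at this
    exact (monomial_mem_reesIdeal hy).mp this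
  | succ c ih =>
    have hw : (I * 𝔪 ^ k * 𝔪).colon (𝔪 : Set R) = I * 𝔪 ^ k := hl k hk
    rw [← hw]
    refine Submodule.mem_colon.mpr fun x hx => ?_
    rw [mul_assoc, ← pow_succ]
    have hxy : y * x ∈ 𝔪 ^ (k + 1) := by
      rw [pow_succ]; exact Ideal.mul_mem_mul hy hx
    refine ih (hk.trans (Nat.le_succ k)) hxy fun q hq => ?_
    have := h (q * degreeOne ⟨x, hx⟩) (by
      rw [pow_succ]; exact Ideal.mul_mem_mul hq (degreeOne_mem_reesIrrelevant _))
    rw [mul_assoc] at this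
    convert this using 2
    exact Subtype.ext (by simp [degreeOne, monomial_mul_monomial, mul_comm])

/-- A generic `x ∈ 𝔪` acts injectively on `⨁ 𝔪ᵏ / I𝔪ᵏ` in high degrees. -/
theorem exists_finset_dual_forall_mem [IsNoetherianRing R] (h𝔪 : 𝔪.IsMaximal) {I : Ideal R}
    (hI : ∀ k, IsSaturatedAt 𝔪 (I * 𝔪 ^ k)) {l : ℕ} (hl : l ∈ daoSet₃ 𝔪 I) :
    ∃ T : Finset (Module.Dual (R ⧸ 𝔪) 𝔪.Cotangent), (∀ φ ∈ T, φ ≠ 0) ∧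
      ∀ x : 𝔪, (∀ φ ∈ T, φ (𝔪.toCotangent x) ≠ 0) →
        ∀ k ≥ l, ∀ y ∈ 𝔪 ^ k, (x : R) * y ∈ I * 𝔪 ^ (k + 1) → y ∈ I * 𝔪 ^ k := by
  classical
  obtain ⟨T, hT, hmul⟩ := exists_finset_prime_forall_pow_mul_mem (reesIdeal 𝔪 I) (reesIrrelevant 𝔪)
  -- By saturation a scalar outside `𝔪` is a nonzerodivisor modulo `ℛ(𝔪, I)`, so it lies in no
  -- associated prime.
  have hPR : ∀ P ∈ T, ∀ r : R, algebraMap R (reesAlgebra 𝔪) r ∈ P → r ∈ 𝔪 := by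
    intro P hP r hr
    obtain ⟨hprime, -, s, hs⟩ := hT P hP
    by_contra hr𝔪
    refine hprime.ne_top ((Ideal.eq_top_iff_one _).mpr ((hs 1).mpr ?_))
    rw [one_mul, mem_reesIdeal]
    intro k
    refine hI k r hr𝔪 _ ?_
    have := mem_reesIdeal.mp ((hs _).mp hr) k
    rwa [MulMemClass.coe_mul, Subalgebra.coe_algebraMap, Polynomial.algebraMap_apply,
      coeff_C_mul] at this
  have hex : ∀ P ∈ T, ∃ φ : Module.Dual (R ⧸ 𝔪) 𝔪.Cotangent, φ ≠ 0 ∧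
      ∀ x : 𝔪, degreeOne x ∈ P → φ (𝔪.toCotangent x) = 0 := fun P hP =>
    exists_dual_of_prime h𝔪 (hT P hP).1 (hPR P hP) (hT P hP).2.1
  choose! φ hφ0 hφ using hex
  refine ⟨T.image φ, ?_, fun x hx k hk y hy hxy => ?_⟩
  · intro ψ hψ
    obtain ⟨P, hP, rfl⟩ := Finset.mem_image.mp hψ
    exact hφ0 P hP
  have hmem : (x : R) * y ∈ 𝔪 ^ (k + 1) := by
    rw [pow_succ']; exact Ideal.mul_mem_mul x.2 hy
  obtain ⟨c, hc⟩ := hmul (degreeOne x) ⟨monomial k y, reesAlgebra.monomial_mem.mpr hy⟩ (by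
    convert (monomial_mem_reesIdeal hmem).mpr hxy using 1
    exact Subtype.ext (by simp [degreeOne, monomial_mul_monomial, add_comm]))
    fun P hP hxP => hx (φ P) (Finset.mem_image_of_mem _ hP) (hφ P hP x hxP)
  exact mem_mul_pow_of_pow_reesIrrelevant_mul hl c hk hy hc

end Superficial

/-! ### Comparison of the three kinds of fullness -/

section DaoNumbers

variable {R : Type u} [CommRing R] {𝔪 I : Ideal R}

/-- Generic superficiality: for generic `x`, `(I𝔪ᵏ⁺¹ : x) = I𝔪ᵏ` for all large
`k`. -/
theorem exists_finset_dual_forall_colon_le [IsNoetherianRing R] (h𝔪 : 𝔪.IsMaximal) {z : R}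
    (hz : z ∈ 𝔪) (hz0 : ∀ y, z * y = 0 → y = 0) (hI : ∀ k, IsSaturatedAt 𝔪 (I * 𝔪 ^ k))
    (h𝔪s : ∀ k, IsSaturatedAt 𝔪 (𝔪 ^ k)) (h0 : IsSaturatedAt 𝔪 ⊥) :
    ∃ T : Finset (Module.Dual (R ⧸ 𝔪) 𝔪.Cotangent), (∀ φ ∈ T, φ ≠ 0) ∧
      ∀ x : 𝔪, (∀ φ ∈ T, φ (𝔪.toCotangent x) ≠ 0) →
        ∃ k₀, ∀ k ≥ k₀, ∀ y : R, y * x ∈ I * 𝔪 ^ (k + 1) → y ∈ I * 𝔪 ^ k := by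
  classical
  -- The ideal `⊥` makes `x` a nonzerodivisor, `𝔪` raises `y` to `𝔪^k`, and `I` moves it from `𝔪^k`
  -- into `I𝔪^k`.
  obtain ⟨l₀, hl₀⟩ := daoSet₃_nonempty hz hz0 ⊥
  obtain ⟨l₁, hl₁⟩ := daoSet₃_nonempty hz hz0 𝔪
  obtain ⟨l₂, hl₂⟩ := daoSet₃_nonempty hz hz0 I
  obtain ⟨T₀, hT₀, hx₀⟩ := exists_finset_dual_forall_mem h𝔪 (fun k => by rwa [Ideal.bot_mul]) hl₀
  obtain ⟨T₁, hT₁, hx₁⟩ := exists_finset_dual_forall_mem h𝔪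
    (fun k => by rw [← pow_succ']; exact h𝔪s _) hl₁
  obtain ⟨T₂, hT₂, hx₂⟩ := exists_finset_dual_forall_mem h𝔪 hI hl₂
  refine ⟨T₀ ∪ (T₁ ∪ T₂), fun φ hφ => ?_, fun x hx => ?_⟩
  · simp only [Finset.mem_union] at hφ
    rcases hφ with h | h | h
    exacts [hT₀ φ h, hT₁ φ h, hT₂ φ h]
  replace hx₀ := hx₀ x fun φ hφ => hx φ (by simp [hφ])
  replace hx₁ := hx₁ x fun φ hφ => hx φ (by simp [hφ])
  replace hx₂ := hx₂ x fun φ hφ => hx φ (by simp [hφ])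
  have hreg : ∀ y, (x : R) * y = 0 → y = 0 := by
    intro y hy
    have hzl : ∀ m : ℕ, ∀ w, z ^ m * w = 0 → w = 0 := by
      intro m
      induction m with
      | zero => intro w h; rwa [pow_zero, one_mul] at h
      | succ m ih =>
        intro w h
        rw [pow_succ, mul_assoc] at h
        exact hz0 _ (ih _ h)
    -- The factor `z ^ l₀` moves `y` into a degree where injectivity of `x` is known.
    have := hx₀ l₀ le_rfl (z ^ l₀ * y) (Ideal.mul_mem_right _ _ (Ideal.pow_mem_pow hz _)) (by
      rw [mul_left_comm, hy, mul_zero]; exact zero_mem _)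
    rw [Ideal.bot_mul, Submodule.mem_bot] at this
    exact hzl _ _ this
  -- Artin–Rees: cancelling `x` costs at most `a` powers of `𝔪`. This puts `y` in `𝔪^{l₁}`, the
  -- start of the climb to `𝔪^k`.
  obtain ⟨a, ha⟩ := Ideal.exists_pow_inf_eq_pow_smul 𝔪 (Ideal.span {(x : R)})
  have hAR : ∀ (k : ℕ) (y : R), y * x ∈ 𝔪 ^ (k + a) → y ∈ 𝔪 ^ k := by
    intro k y hy
    have h1 : y * x ∈ (𝔪 ^ (k + a) • ⊤ ⊓ Ideal.span {(x : R)} : Submodule R R) :=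
      ⟨by simpa using hy, Ideal.mem_span_singleton'.mpr ⟨y, rfl⟩⟩
    rw [ha _ (Nat.le_add_left a k), Nat.add_sub_cancel] at h1
    have h2 : y * x ∈ 𝔪 ^ k * Ideal.span {(x : R)} := Submodule.smul_mono le_rfl inf_le_right h1
    obtain ⟨w, hw, hwx⟩ := Ideal.mem_mul_span_singleton.mp h2
    have : y - w = 0 := hreg _ (by rw [mul_comm, sub_mul, hwx, sub_self])
    rwa [sub_eq_zero.mp this]
  refine ⟨max l₂ (l₁ + a), fun k hk y hy => ?_⟩
  have hk₂ : l₂ ≤ k := (le_max_left _ _).trans hk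
  have hk₁ : l₁ + a ≤ k := (le_max_right _ _).trans hk
  have hy𝔪 : y * x ∈ 𝔪 ^ (k + 1) := Ideal.mul_le_right hy
  have hclimb : ∀ j, l₁ + j ≤ k → y ∈ 𝔪 ^ (l₁ + j) := by
    intro j
    induction j with
    | zero => exact fun _ => hAR _ _ (Ideal.pow_le_pow_right (by omega) hy𝔪)
    | succ j ih =>
      intro hj
      have := hx₁ (l₁ + j) (Nat.le_add_right _ _) y (ih (by omega)) (by
        rw [← pow_succ', mul_comm]
        exact Ideal.pow_le_pow_right (by omega) hy𝔪)
      rwa [← pow_succ'] at this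
  have hyk : y ∈ 𝔪 ^ k := by
    have := hclimb (k - l₁) (by omega)
    rwa [Nat.add_sub_cancel' (by omega)] at this
  exact hx₂ k hk₂ y hyk (by rwa [mul_comm (x : R)])

theorem daoSet₃_subset_daoSet₁ [IsNoetherianRing R] (h𝔪 : 𝔪.IsMaximal) (hK : Infinite (R ⧸ 𝔪))
    {z : R} (hz : z ∈ 𝔪) (hz0 : ∀ y, z * y = 0 → y = 0)
    (hI : ∀ k, IsSaturatedAt 𝔪 (I * 𝔪 ^ k)) (h𝔪s : ∀ k, IsSaturatedAt 𝔪 (𝔪 ^ k))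
    (h0 : IsSaturatedAt 𝔪 ⊥) : daoSet₃ 𝔪 I ⊆ daoSet₁ 𝔪 I := by
  let _ := Ideal.Quotient.field 𝔪
  obtain ⟨T, hT, hx⟩ := exists_finset_dual_forall_colon_le h𝔪 hz hz0 hI h𝔪s h0
  intro l hl k hk
  refine ⟨_, isZariskiOpen_ne_zero T, nonempty_ne_zero T hT, fun x _ hxT => ?_⟩
  obtain ⟨k₀, hk₀⟩ := hx x hxT
  -- Descent from large degrees by weak fullness. The bound `k₀` may depend on `x`, but the open set
  -- given by `T` does not.
  have key : ∀ j k, l ≤ k → k₀ ≤ k + j → ∀ y : R, y * x ∈ I * 𝔪 ^ (k + 1) → y ∈ I * 𝔪 ^ k := by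
    intro j
    induction j with
    | zero => exact fun k _ h => hk₀ k h
    | succ j ih =>
      intro k hk h y hy
      have hw : (I * 𝔪 ^ k * 𝔪).colon (𝔪 : Set R) = I * 𝔪 ^ k := hl k hk
      rw [← hw]
      refine Submodule.mem_colon.mpr fun w hw => ?_
      rw [mul_assoc, ← pow_succ]
      refine ih (k + 1) (by omega) (by omega) _ ?_
      rw [smul_eq_mul, mul_right_comm, pow_succ, ← mul_assoc]
      exact Ideal.mul_mem_mul hy hw
  refine le_antisymm (fun y hy => ?_) fun y hy => ?_
  · rw [Submodule.mem_colon_singleton, smul_eq_mul, mul_assoc, ← pow_succ] at hy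
    exact key k₀ k hk (Nat.le_add_left _ _) y hy
  · rw [Submodule.mem_colon_singleton]
    exact Ideal.mul_mem_mul hy x.2

theorem ForGeneric.mono {P Q : R → Prop} (hP : ForGeneric 𝔪 P) (h : ∀ x ∈ 𝔪, P x → Q x) :
    ForGeneric 𝔪 Q := by
  obtain ⟨U, hU, hne, hx⟩ := hP
  exact ⟨U, hU, hne, fun x h2 hxU => h x x.2 (hx x h2 hxU)⟩

theorem cotangent_nontrivial [IsNoetherianRing R] (h𝔪 : 𝔪 ≠ ⊤) {z : R} (hz : z ∈ 𝔪)
    (hz0 : ∀ y, z * y = 0 → y = 0) : Nontrivial 𝔪.Cotangent := by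
  by_contra h
  rw [not_nontrivial_iff_subsingleton] at h
  obtain ⟨r, hr, hr0⟩ := exists_notMem_forall_smul_mem h𝔪 ⊥
    fun x => ⟨0, zero_mem _, Subsingleton.elim _ _⟩
  have h1 := congrArg Subtype.val ((Submodule.mem_bot R).mp (hr0 ⟨z, hz⟩))
  have h2 : r = 0 := hz0 r (by rw [mul_comm]; exact h1)
  exact hr (h2 ▸ zero_mem _)

/-- A property could hold generically for want of any `x ∉ 𝔪²` in the open set; a non-zero class in
it rules this out. -/
theorem ForGeneric.exists_mem [IsNoetherianRing R] (h𝔪 : 𝔪.IsMaximal) (hK : Infinite (R ⧸ 𝔪))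
    {z : R} (hz : z ∈ 𝔪) (hz0 : ∀ y, z * y = 0 → y = 0) {P : R → Prop}
    (hP : ForGeneric 𝔪 P) : ∃ x ∈ 𝔪, P x := by
  let _ := Ideal.Quotient.field 𝔪
  have := cotangent_nontrivial h𝔪.ne_top hz hz0
  obtain ⟨U, hU, hne, hx⟩ := hP
  obtain ⟨v, hv, hv0⟩ := IsZariskiOpen.exists_ne_zero (K := R ⧸ 𝔪) hU hne
  obtain ⟨x, rfl⟩ := 𝔪.toCotangent_surjective v
  exact ⟨x, x.2, hx x (fun h => hv0 ((𝔪.toCotangent_eq_zero x).mpr h)) hv⟩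

/-- The same `x` works: `yx ∈ I` gives `(yw)x ∈ I𝔪` for `w ∈ 𝔪`, hence `yw ∈ (I𝔪 : x) = I`. -/
theorem IsMFull.isFull (h : IsMFull 𝔪 I) : IsFull 𝔪 I := by
  refine ForGeneric.mono h fun x hx hxI => le_antisymm (fun y hy => ?_) ?_
  · refine Submodule.mem_colon.mpr fun w hw => ?_
    rw [← hxI, Submodule.mem_colon_singleton]
    rw [Submodule.mem_colon_singleton] at hy
    rw [smul_eq_mul, smul_eq_mul, mul_right_comm]
    exact Ideal.mul_mem_mul hy hw
  · exact Submodule.colon_mono le_rfl (Set.singleton_subset_iff.mpr hx)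

theorem IsMFull.isWeaklyMFull [IsNoetherianRing R] (h𝔪 : 𝔪.IsMaximal) (hK : Infinite (R ⧸ 𝔪))
    {z : R} (hz : z ∈ 𝔪) (hz0 : ∀ y, z * y = 0 → y = 0) (h : IsMFull 𝔪 I) :
    IsWeaklyMFull 𝔪 I := by
  obtain ⟨x, hx, hxI⟩ := ForGeneric.exists_mem h𝔪 hK hz hz0 h
  refine le_antisymm ?_ le_colon_mul
  exact (Submodule.colon_mono le_rfl (Set.singleton_subset_iff.mpr hx)).trans hxI.le

theorem exists_mem_of_depth_pos (h : 0 < depth 𝔪) : ∃ z ∈ 𝔪, ∀ y, z * y = 0 → y = 0 := by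
  obtain ⟨rs, h⟩ := lt_iSup_iff.mp h
  obtain ⟨⟨hrs, hreg⟩, h⟩ := lt_iSup_iff.mp h
  cases rs with
  | nil => simp at h
  | cons z rs =>
    refine ⟨z, hrs z (by simp), fun y hy => ?_⟩
    have hz := ((RingTheory.Sequence.isWeaklyRegular_cons_iff R z rs).mp
      hreg.toIsWeaklyRegular).1
    exact hz (by simpa using hy)

/-! ### The graded case -/

section Graded

variable {K : Type v} [Field K] [Algebra K R] {𝒜 : ℕ → Submodule K R} [GradedAlgebra 𝒜]

theorem exists_sub_algebraMap_mem_irrelevant (h : 𝒜 0 = 1) (r : R) :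
    ∃ c : K, r - algebraMap K R c ∈ (HomogeneousIdeal.irrelevant 𝒜).toIdeal := by
  have h0 : (DirectSum.decompose 𝒜 r 0 : R) ∈ (1 : Submodule K R) :=
    h ▸ (DirectSum.decompose 𝒜 r 0).2
  obtain ⟨c, hc⟩ := Submodule.mem_one.mp h0
  refine ⟨c, ?_⟩
  have hc0 : algebraMap K R c ∈ 𝒜 0 := by rw [hc]; exact SetLike.coe_mem _
  change r - algebraMap K R c ∈ HomogeneousIdeal.irrelevant 𝒜
  rw [HomogeneousIdeal.mem_irrelevant_iff, GradedRing.proj_apply, DirectSum.decompose_sub,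
    DirectSum.sub_apply, AddSubgroupClass.coe_sub, DirectSum.decompose_of_mem_same 𝒜 hc0, hc,
    sub_self]

theorem isMaximal_irrelevant [Nontrivial R] (h : 𝒜 0 = 1) :
    (HomogeneousIdeal.irrelevant 𝒜).toIdeal.IsMaximal := by
  refine Ideal.isMaximal_iff.mpr ⟨fun h1 => ?_, fun J r hJ hr hrJ => ?_⟩
  · have h2 := (HomogeneousIdeal.mem_irrelevant_iff 𝒜 1).mp h1
    rw [GradedRing.proj_apply, DirectSum.decompose_of_mem_same 𝒜 SetLike.GradedOne.one_mem] at h2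
    exact one_ne_zero h2
  · obtain ⟨c, hc⟩ := exists_sub_algebraMap_mem_irrelevant h r
    have hc0 : c ≠ 0 := by
      rintro rfl
      rw [map_zero, sub_zero] at hc
      exact hr hc
    have h1 : algebraMap K R c ∈ J := by
      rw [← sub_sub_cancel r (algebraMap K R c)]
      exact sub_mem hrJ (hJ hc)
    have h2 := J.mul_mem_left (algebraMap K R c⁻¹) h1
    rwa [← map_mul, inv_mul_cancel₀ hc0, map_one] at h2

/-- An element `r` outside the irrelevant ideal has constant term `c ≠ 0`. The degree `n` part of
`ry` is `c y_n` plus multiples of lower components of `y`, so all `y_n` lie in `J` by induction. -/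
theorem isSaturatedAt_of_isHomogeneous (h : 𝒜 0 = 1) {J : Ideal R} (hJ : J.IsHomogeneous 𝒜) :
    IsSaturatedAt (HomogeneousIdeal.irrelevant 𝒜).toIdeal J := by
  intro r hr y hy
  obtain ⟨c, hc⟩ := Submodule.mem_one.mp (h ▸ (DirectSum.decompose 𝒜 r 0).2 :
    (DirectSum.decompose 𝒜 r 0 : R) ∈ (1 : Submodule K R))
  have hc0 : c ≠ 0 := by
    rintro rfl
    rw [map_zero] at hc
    exact hr ((HomogeneousIdeal.mem_irrelevant_iff 𝒜 r).mpr hc.symm)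
  rw [hJ.mem_iff]
  intro n
  induction n using Nat.strong_induction_on with
  | _ n ih =>
    have h1 := (hJ.mem_iff 𝒜).mp hy n
    rw [DirectSum.decompose_mul, DirectSum.coe_mul_apply_eq_sum_antidiagonal,
      ← Finset.add_sum_erase _ _ (show (0, n) ∈ Finset.HasAntidiagonal.antidiagonal n by
        simp), ← hc] at h1
    have h2 : ∑ p ∈ (Finset.HasAntidiagonal.antidiagonal n).erase (0, n),
        (DirectSum.decompose 𝒜 r p.1 : R) * DirectSum.decompose 𝒜 y p.2 ∈ J := by
      refine Ideal.sum_mem _ fun p hp => J.mul_mem_left _ (ih _ ?_)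
      obtain ⟨hne, hp⟩ := Finset.mem_erase.mp hp
      have hp := Finset.HasAntidiagonal.mem_antidiagonal.mp hp
      by_contra hlt
      exact hne (Prod.ext (by simp only; omega) (by simp only; omega))
    have h3 := J.mul_mem_left (algebraMap K R c⁻¹) ((J.add_mem_iff_left h2).mp h1)
    rwa [← mul_assoc, ← map_mul, inv_mul_cancel₀ hc0, map_one, one_mul] at h3

end Graded

end DaoNumbers

end Dao

end

theorem theorem1p1 {R : Type u} [CommRing R] [IsNoetherianRing R] (𝔪 I : Ideal R)
    -- either `(R, 𝔪)` is local, or `R` is standard graded over a field, `𝔪 = R₊`, `I` homogeneous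
    (hR : (∃ _ : IsLocalRing R, 𝔪 = IsLocalRing.maximalIdeal R) ∨
      ∃ (K : Type v) (_ : Field K) (_ : Algebra K R) (𝒜 : ℕ → Submodule K R)
        (_ : GradedAlgebra 𝒜), Dao.IsStandardGraded 𝒜 ∧
          𝔪 = (HomogeneousIdeal.irrelevant 𝒜).toIdeal ∧ I.IsHomogeneous 𝒜)
    (hK : Infinite (R ⧸ 𝔪)) (hdepth : 0 < Dao.depth 𝔪) :
    -- the Dao numbers are well defined
    ((Dao.daoSet₁ 𝔪 I).Nonempty ∧ (Dao.daoSet₂ 𝔪 I).Nonempty ∧ (Dao.daoSet₃ 𝔪 I).Nonempty) ∧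
    Dao.daoNumber₂ 𝔪 I ≤ Dao.daoNumber₃ 𝔪 I ∧
    Dao.daoNumber₃ 𝔪 I = Dao.daoNumber₁ 𝔪 I ∧
    -- the regularities exist and bound the Dao numbers (the zero module has regularity `-∞`)
    (I ≠ ⊥ → ∀ (n : ℕ) (y : Fin n → reesAlgebra 𝔪), Dao.IsMinimalHomogeneousGenerators 𝔪 y →
      ∃ r₁ r₂ : ℤ,
        Dao.IsRegularity (M := Dao.reesModule 𝔪 I) (Dao.component (Dao.reesModule 𝔪 I)) y r₁ ∧
        Dao.IsRegularity (M := Dao.reesColon 𝔪 I) (Dao.component (Dao.reesColon 𝔪 I)) y r₂ ∧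
        (Dao.daoNumber₁ 𝔪 I : ℤ) ≤ max r₁ r₂) ∧
    -- the two descriptions of the colon module
    Dao.reesColon 𝔪 I =
      Dao.polynomialColon (Dao.truncation (Dao.reesModule 𝔪 I)) (Dao.reesModule 𝔪 𝔪) ∧
    (∀ f : Polynomial R, f ∈ Dao.reesColon 𝔪 I ↔
      f.coeff 0 = 0 ∧ ∀ k : ℕ, f.coeff (k + 1) ∈ (I * 𝔪 ^ (k + 1)).colon (𝔪 : Set R)) := by
  obtain ⟨h𝔪, hI, h𝔪s, h0⟩ : 𝔪.IsMaximal ∧ (∀ k, Dao.IsSaturatedAt 𝔪 (I * 𝔪 ^ k)) ∧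
      (∀ k, Dao.IsSaturatedAt 𝔪 (𝔪 ^ k)) ∧ Dao.IsSaturatedAt 𝔪 ⊥ := by
    rcases hR with ⟨_, rfl⟩ | ⟨K, _, _, 𝒜, _, hstd, rfl, hhom⟩
    · have h : ∀ J : Ideal R, Dao.IsSaturatedAt (IsLocalRing.maximalIdeal R) J := fun J r hr y hy =>
        (J.unit_mul_mem_iff_mem (IsLocalRing.notMem_maximalIdeal.mp hr)).mp hy
      exact ⟨inferInstance, fun _ => h _, fun _ => h _, h _⟩
    · have := hstd.nontrivial
      have h𝔪 : ∀ k : ℕ, ((HomogeneousIdeal.irrelevant 𝒜).toIdeal ^ k).IsHomogeneous 𝒜 := by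
        intro k
        induction k with
        | zero => rw [pow_zero, Ideal.one_eq_top]; exact Ideal.IsHomogeneous.top 𝒜
        | succ k ih => rw [pow_succ]; exact ih.mul (HomogeneousIdeal.isHomogeneous _)
      exact ⟨Dao.isMaximal_irrelevant hstd.degree_zero,
        fun k => Dao.isSaturatedAt_of_isHomogeneous hstd.degree_zero (hhom.mul (h𝔪 k)),
        fun k => Dao.isSaturatedAt_of_isHomogeneous hstd.degree_zero (h𝔪 k),
        Dao.isSaturatedAt_of_isHomogeneous hstd.degree_zero (Ideal.IsHomogeneous.bot 𝒜)⟩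
  obtain ⟨z, hz, hz0⟩ := Dao.exists_mem_of_depth_pos hdepth
  have h31 := Dao.daoSet₃_subset_daoSet₁ h𝔪 hK hz hz0 hI h𝔪s h0
  have h13 : Dao.daoSet₁ 𝔪 I ⊆ Dao.daoSet₃ 𝔪 I := fun l hl k hk =>
    (hl k hk).isWeaklyMFull h𝔪 hK hz hz0
  have h12 : Dao.daoSet₁ 𝔪 I ⊆ Dao.daoSet₂ 𝔪 I := fun l hl k hk => (hl k hk).isFull
  have heq : Dao.daoSet₃ 𝔪 I = Dao.daoSet₁ 𝔪 I := h31.antisymm h13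
  have hne := Dao.daoSet₃_nonempty hz hz0 I
  have hnum : Dao.daoNumber₃ 𝔪 I = Dao.daoNumber₁ 𝔪 I := by
    rw [Dao.daoNumber₃, heq, Dao.daoNumber₁]
  refine ⟨⟨heq ▸ hne, (heq ▸ hne).mono h12, hne⟩, ?_, hnum, ?_,
    Dao.reesColon_eq_polynomialColon hz hz0, fun f => Dao.mem_reesColon_iff hz hz0⟩
  · exact Nat.sInf_le (h12 (h31 (Nat.sInf_mem hne)))
  · intro hI0 n y hy
    have := Dao.isNoetherian_reesModule (𝔪 := 𝔪) (I := I)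
    have := Dao.isNoetherian_reesColon (I := I) hz hz0
    obtain ⟨r₁, hr₁⟩ := Dao.exists_isRegularity Dao.isGraded_reesModule
      (Dao.reesModule_ne_bot (𝔪 := 𝔪) hI0) hy.isDegreeOne hy.span_eq
    obtain ⟨r₂, hr₂⟩ := Dao.exists_isRegularity Dao.isGraded_reesColon
      (Dao.reesColon_ne_bot (𝔪 := 𝔪) hI0) hy.isDegreeOne hy.span_eq
    -- The regularity of the colon module alone already bounds the Dao number.
    refine ⟨r₁, r₂, hr₁, hr₂, le_max_of_le_right ?_⟩
    have h1 := Dao.one_le_of_isRegularity_reesColon hz hz0 hI0 hy.isDegreeOne hr₂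
    have h2 : Dao.daoNumber₁ 𝔪 I ≤ r₂.toNat := Nat.sInf_le
      (h31 (Dao.toNat_mem_daoSet₃_of_isRegularity hz hz0 hI0 hy.isDegreeOne hr₂))
    omega
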